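/- Let $\mathbb D$ be the open unit disc and $H(\mathbb D)$ the space of analytic functions on $\mathbb D$. Let $p,q\in(0,\infty)$ and $n\in\mathbb N_0$. Let $\phi:[0,1)\to(0,\infty)$ be normal, that is, continuous and such that for some constants $b>a>0$ the function $\phi(r)/(1-r)^a$ is non-increasing on $[0,1)$ with limit $0$ as $r\to1^-$, and $\phi(r)/(1-r)^b$ is non-decreasing on $[0,1)$ with limit $\infty$ as $r\to1^-$. Let $\mu$ be a positive continuous function on $\mathbb D$, let $g\in H(\mathbb D)$, and let $\varphi:\mathbb D\to\mathbb D$ be analytic. Let $H(p,q,\phi)$ be the space of all $f\in H(\mathbb D)$ with $$\|f\|_{p,q,\phi}^p=\int_0^1\Big(\frac1{2\pi}\int_0^{2\pi}|f(re^{i\theta})|^q\,d\theta\Big)^{p/q}\frac{\phi(r)^p}{1-r}\,dr<\infty,$$ and let $\mathcal B_\mu$ be the space of all $f\in H(\mathbb D)$ with $\|f\|_{\mathcal B_\mu}=|f(0)|+\sup_{z\in\mathbb D}\mu(|z|)|f'(z)|<\infty$, with this norm. Define $$(C^n_{\varphi,g}f)(z)=\int_0^z f^{(n)}(\varphi(\xi))\,g(\xi)\,d\xi,\qquad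 f\in H(\mathbb D),\ z\in\mathbb D,$$ and assume that $C^n_{\varphi,g}$ maps $H(p,q,\phi)$ into $\mathcal B_\mu$. Then the operator $C^n_{\varphi,g}:H(p,q,\phi)\to\mathcal B_\mu$ is compact, i.e. maps each $\|\cdot\|_{p,q,\phi}$-bounded set to a relatively compact subset of $\mathcal B_\mu$, if and only if $$\limsup_{|\varphi(z)|\to1}\frac{\mu(|z|)\,|g(z)|}{\phi(|\varphi(z)|)\,(1-|\varphi(z)|^2)^{1/q+n}}=0,$$ where the limsup is $\lim_{\delta\to1^-}\sup\{\cdots : z\in\mathbb D,\ \delta<|\varphi(z)|\}$, and is read as $0$ if $\sup_{\mathbb D}|\varphi|<1$. -/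

import Mathlib

open Set Filter Topology MeasureTheory Metric
open scoped ENNReal NNReal

noncomputable section

/-! # Analytic functions on the unit disc -/

/-- The space `H(𝔻)` of analytic functions on the open unit disc `𝔻 = ball 0 1`, as a complex vector
space. A function on `𝔻` is represented by its extension by `0` to `ℂ`, so that two elements are
equal exactly when they agree on `𝔻`. -/
def HolDisc : Submodule ℂ (ℂ → ℂ) where
  carrier := {f | DifferentiableOn ℂ f (ball 0 1) ∧ ∀ z ∉ ball (0 : ℂ) 1, f z = 0}
  zero_mem' := ⟨differentiableOn_const 0, fun _ _ => rfl⟩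
  add_mem' := by
    rintro f g ⟨hf, hf0⟩ ⟨hg, hg0⟩
    exact ⟨hf.add hg, fun z hz => by simp [hf0 z hz, hg0 z hz]⟩
  smul_mem' := by
    rintro c f ⟨hf, hf0⟩
    exact ⟨hf.const_smul c, fun z hz => by simp [hf0 z hz]⟩

/-! # Mixed-norm spaces -/

/-- A positive continuous function `φ` on `[0,1)` is normal if for some `b > a > 0` the function
`φ(r)/(1-r)^a` is non-increasing with limit `0`, and `φ(r)/(1-r)^b` is non-decreasing with limit
`∞`, as `r → 1⁻`. -/
structure IsNormalFunction (φ : ℝ → ℝ) : Prop where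
  continuousOn : ContinuousOn φ (Ico 0 1)
  pos : ∀ r ∈ Ico (0 : ℝ) 1, 0 < φ r
  exists_exponents : ∃ a b : ℝ, 0 < a ∧ a < b ∧
    AntitoneOn (fun r => φ r / (1 - r) ^ a) (Ico 0 1) ∧
    Tendsto (fun r => φ r / (1 - r) ^ a) (𝓝[<] 1) (𝓝 0) ∧
    MonotoneOn (fun r => φ r / (1 - r) ^ b) (Ico 0 1) ∧
    Tendsto (fun r => φ r / (1 - r) ^ b) (𝓝[<] 1) atTop

/-- The integral mean `M_q(f,r) = ((1/2π) ∫_0^{2π} |f(r e^{iθ})|^q dθ)^{1/q}`. -/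
def integralMean (q : ℝ) (f : ℂ → ℂ) (r : ℝ) : ℝ≥0∞ :=
  (ENNReal.ofReal (1 / (2 * Real.pi)) *
    ∫⁻ θ in Ioc (0 : ℝ) (2 * Real.pi), ‖f (r * Complex.exp (θ * Complex.I))‖ₑ ^ q) ^ (1 / q)

/-- The (quasi-)norm `‖f‖_{p,q,φ} = (∫_0^1 M_q(f,r)^p φ(r)^p / (1-r) dr)^{1/p}`,
with values in `[0,∞]`. -/
def mixedNorm (p q : ℝ) (φ : ℝ → ℝ) (f : ℂ → ℂ) : ℝ≥0∞ :=
  (∫⁻ r in Ioo (0 : ℝ) 1, integralMean q f r ^ p * ENNReal.ofReal (φ r ^ p / (1 - r))) ^ (1 / p)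

/-- The mixed-norm space `H(p,q,φ)`: the analytic functions on `𝔻` with `‖f‖_{p,q,φ} < ∞`. -/
def mixedNormSpace (p q : ℝ) (φ : ℝ → ℝ) : Set HolDisc :=
  {f | mixedNorm p q φ (f : ℂ → ℂ) < ∞}

/-! # Weighted Bloch spaces -/

/-- A weight: a positive continuous function on `𝔻`. -/
structure DiscWeight where
  toFun : ℂ → ℝ
  continuousOn : ContinuousOn toFun (ball 0 1)
  pos : ∀ z ∈ ball (0 : ℂ) 1, 0 < toFun z

/-- The value `μ(r)` of a weight at a radius `r ∈ [0,1)`. -/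
def DiscWeight.radial (μ : DiscWeight) (r : ℝ) : ℝ := μ.toFun (r : ℂ)

lemma DiscWeight.radial_pos (μ : DiscWeight) (z : ball (0 : ℂ) 1) : 0 < μ.radial ‖(z : ℂ)‖ :=
  μ.pos _ (by simpa using mem_ball_zero_iff.1 z.2)

/-- The functions in `H(𝔻)` with `sup_{z ∈ 𝔻} μ(|z|)|f'(z)| < ∞`. -/
def blochSubmodule (μ : DiscWeight) : Submodule ℂ HolDisc where
  carrier := {f | BddAbove (range fun z : ball (0 : ℂ) 1 =>
    μ.radial ‖(z : ℂ)‖ * ‖deriv (f : ℂ → ℂ) z‖)}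
  zero_mem' := ⟨0, by
    rintro _ ⟨z, rfl⟩
    simp⟩
  add_mem' := by
    rintro f g ⟨A, hA⟩ ⟨B, hB⟩
    refine ⟨A + B, ?_⟩
    rintro _ ⟨z, rfl⟩
    have h1 := hA ⟨z, rfl⟩
    have h2 := hB ⟨z, rfl⟩
    have hd : deriv ((f + g : HolDisc) : ℂ → ℂ) z = deriv (f : ℂ → ℂ) z + deriv (g : ℂ → ℂ) z :=
      deriv_add (f.2.1.differentiableAt (isOpen_ball.mem_nhds z.2))
        (g.2.1.differentiableAt (isOpen_ball.mem_nhds z.2))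
    have := mul_le_mul_of_nonneg_left (norm_add_le (deriv (f : ℂ → ℂ) z) (deriv (g : ℂ → ℂ) z))
      (μ.radial_pos z).le
    simp only [hd] at *
    linarith
  smul_mem' := by
    rintro c f ⟨A, hA⟩
    refine ⟨‖c‖ * A, ?_⟩
    rintro _ ⟨z, rfl⟩
    have h1 := mul_le_mul_of_nonneg_left (hA ⟨z, rfl⟩) (norm_nonneg c)
    have hd : deriv ((c • f : HolDisc) : ℂ → ℂ) z = c * deriv (f : ℂ → ℂ) z :=
      deriv_const_mul c (f.2.1.differentiableAt (isOpen_ball.mem_nhds z.2))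
    simp only [hd, norm_mul] at *
    linarith

/-- The weighted Bloch space `ℬ_μ`; it carries the topology of its norm, defined below. -/
def Bloch (μ : DiscWeight) : Type := blochSubmodule μ

namespace Bloch

variable {μ : DiscWeight}

instance : AddCommGroup (Bloch μ) := inferInstanceAs (AddCommGroup (blochSubmodule μ))

instance : Module ℂ (Bloch μ) := inferInstanceAs (Module ℂ (blochSubmodule μ))

/-- The analytic function underlying an element of `ℬ_μ`. -/
def toHol (f : Bloch μ) : HolDisc := Subtype.val (p := fun x => x ∈ blochSubmodule μ) f

/-- The Bloch norm `|f(0)| + sup_{z ∈ 𝔻} μ(|z|)|f'(z)|`. -/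
instance : Norm (Bloch μ) where
  norm f := ‖(f.toHol : ℂ → ℂ) 0‖ +
    ⨆ z : ball (0 : ℂ) 1, μ.radial ‖(z : ℂ)‖ * ‖deriv (f.toHol : ℂ → ℂ) z‖

lemma norm_def (f : Bloch μ) : ‖f‖ = ‖(f.toHol : ℂ → ℂ) 0‖ +
    ⨆ z : ball (0 : ℂ) 1, μ.radial ‖(z : ℂ)‖ * ‖deriv (f.toHol : ℂ → ℂ) z‖ := rfl

lemma bddAbove (f : Bloch μ) : BddAbove (range fun z : ball (0 : ℂ) 1 =>
    μ.radial ‖(z : ℂ)‖ * ‖deriv (f.toHol : ℂ → ℂ) z‖) :=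
  Subtype.property (p := fun x => x ∈ blochSubmodule μ) f

lemma core : NormedSpace.Core ℂ (Bloch μ) where
  norm_nonneg f := add_nonneg (norm_nonneg _)
    (Real.iSup_nonneg fun z => mul_nonneg (μ.radial_pos z).le (norm_nonneg _))
  norm_smul c f := by
    have hd (z : ball (0 : ℂ) 1) :
        deriv ((c • f).toHol : ℂ → ℂ) z = c * deriv (f.toHol : ℂ → ℂ) z :=
      deriv_const_mul c (f.toHol.2.1.differentiableAt (isOpen_ball.mem_nhds z.2))
    have h0 : ((c • f).toHol : ℂ → ℂ) 0 = c * (f.toHol : ℂ → ℂ) 0 := rfl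
    simp only [norm_def, hd, h0, norm_mul, mul_add, Real.mul_iSup_of_nonneg (norm_nonneg c)]
    congr 2
    ext z
    ring
  norm_triangle f g := by
    have hd (z : ball (0 : ℂ) 1) : deriv ((f + g).toHol : ℂ → ℂ) z =
        deriv (f.toHol : ℂ → ℂ) z + deriv (g.toHol : ℂ → ℂ) z :=
      deriv_add (f.toHol.2.1.differentiableAt (isOpen_ball.mem_nhds z.2))
        (g.toHol.2.1.differentiableAt (isOpen_ball.mem_nhds z.2))
    have h0 : ((f + g).toHol : ℂ → ℂ) 0 = (f.toHol : ℂ → ℂ) 0 + (g.toHol : ℂ → ℂ) 0 := rfl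
    have : Nonempty (ball (0 : ℂ) 1) := ⟨⟨0, by simp⟩⟩
    have h1 : (⨆ z : ball (0 : ℂ) 1, μ.radial ‖(z : ℂ)‖ * ‖deriv ((f + g).toHol : ℂ → ℂ) z‖) ≤
        (⨆ z : ball (0 : ℂ) 1, μ.radial ‖(z : ℂ)‖ * ‖deriv (f.toHol : ℂ → ℂ) z‖) +
        ⨆ z : ball (0 : ℂ) 1, μ.radial ‖(z : ℂ)‖ * ‖deriv (g.toHol : ℂ → ℂ) z‖ := by
      refine ciSup_le fun z => ?_
      have hf := le_ciSup f.bddAbove z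
      have hg := le_ciSup g.bddAbove z
      have := mul_le_mul_of_nonneg_left
        (norm_add_le (deriv (f.toHol : ℂ → ℂ) z) (deriv (g.toHol : ℂ → ℂ) z)) (μ.radial_pos z).le
      simp only [hd] at *
      linarith
    have h2 := norm_add_le ((f.toHol : ℂ → ℂ) 0) ((g.toHol : ℂ → ℂ) 0)
    simp only [norm_def, h0]
    linarith
  norm_eq_zero_iff f := by
    constructor
    · intro h
      rw [norm_def] at h
      have hn : 0 ≤ ⨆ z : ball (0 : ℂ) 1, μ.radial ‖(z : ℂ)‖ * ‖deriv (f.toHol : ℂ → ℂ) z‖ :=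
        Real.iSup_nonneg fun z => mul_nonneg (μ.radial_pos z).le (norm_nonneg _)
      have h0 : ‖(f.toHol : ℂ → ℂ) 0‖ = 0 := by linarith [norm_nonneg ((f.toHol : ℂ → ℂ) 0)]
      have hs : (⨆ z : ball (0 : ℂ) 1, μ.radial ‖(z : ℂ)‖ * ‖deriv (f.toHol : ℂ → ℂ) z‖) = 0 := by
        linarith [norm_nonneg ((f.toHol : ℂ → ℂ) 0)]
      have hd (z : ℂ) (hz : z ∈ ball (0 : ℂ) 1) : deriv (f.toHol : ℂ → ℂ) z = 0 := by
        have h1 := le_ciSup f.bddAbove ⟨z, hz⟩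
        rw [hs] at h1
        have h2 := μ.radial_pos ⟨z, hz⟩
        exact norm_le_zero_iff.1 (nonpos_of_mul_nonpos_right h1 h2)
      have hfun : (f.toHol : ℂ → ℂ) = 0 := by
        ext z
        by_cases hz : z ∈ ball (0 : ℂ) 1
        · have := isOpen_ball.is_const_of_deriv_eq_zero (convex_ball (0 : ℂ) 1).isPreconnected
            f.toHol.2.1 hd hz (mem_ball_self one_pos)
          simpa [this] using h0
        · exact f.toHol.2.2 z hz
      exact Subtype.ext (Subtype.ext hfun)
    · rintro rfl
      have hd (z : ball (0 : ℂ) 1) : deriv ((0 : Bloch μ).toHol : ℂ → ℂ) z = 0 :=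
        deriv_const (z : ℂ) (0 : ℂ)
      have h0 : ((0 : Bloch μ).toHol : ℂ → ℂ) 0 = 0 := rfl
      simp [norm_def, hd, h0]

instance : NormedAddCommGroup (Bloch μ) := NormedAddCommGroup.ofCore core

instance : NormedSpace ℂ (Bloch μ) := NormedSpace.ofCore core

end Bloch

/-! # Generalized integration operators -/

lemma differentiableOn_iteratedDeriv_holDisc (n : ℕ) (f : HolDisc) :
    DifferentiableOn ℂ (iteratedDeriv n (f : ℂ → ℂ)) (ball 0 1) := by
  induction n with
  | zero => simpa using f.2.1
  | succ n ih => rw [iteratedDeriv_succ]; exact ih.deriv isOpen_ball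

/-- The integral `∫_0^z h(ξ) dξ` along the segment from `0` to `z`. -/
def segmentIntegral (h : ℂ → ℂ) (z : ℂ) : ℂ := ∫ t in (0 : ℝ)..1, z * h (t * z)

lemma ofReal_mul_mem_disc {z : ℂ} (hz : z ∈ ball (0 : ℂ) 1) {t : ℝ} (ht : t ∈ uIcc (0 : ℝ) 1) :
    (t : ℂ) * z ∈ ball (0 : ℂ) 1 := by
  rw [uIcc_of_le zero_le_one] at ht
  simp only [mem_ball_zero_iff, norm_mul, Complex.norm_real, Real.norm_eq_abs,
    abs_of_nonneg ht.1] at *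
  nlinarith [ht.2, norm_nonneg z]

lemma continuousOn_segment {h : ℂ → ℂ} (hh : DifferentiableOn ℂ h (ball 0 1)) {z : ℂ}
    (hz : z ∈ ball (0 : ℂ) 1) : ContinuousOn (fun t : ℝ => z * h (t * z)) (uIcc 0 1) :=
  continuousOn_const.mul <| hh.continuousOn.comp (by fun_prop) fun _ ht => ofReal_mul_mem_disc hz ht

lemma hasDerivAt_segmentIntegral {h : ℂ → ℂ} (hh : DifferentiableOn ℂ h (ball 0 1)) {z : ℂ}
    (hz : z ∈ ball (0 : ℂ) 1) : HasDerivAt (segmentIntegral h) (h z) z := by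
  obtain ⟨F, hF⟩ := hh.isExactOn_ball
  have key : ∀ w ∈ ball (0 : ℂ) 1, segmentIntegral h w = F w - F 0 := by
    intro w hw
    have hder : ∀ t ∈ uIcc (0 : ℝ) 1,
        HasDerivAt (fun t : ℝ => F (t * w)) (w * h (t * w)) t := by
      intro t ht
      have h1 : HasDerivAt (fun s : ℂ => s * w) w (t : ℂ) := by
        simpa using (hasDerivAt_id (t : ℂ)).mul_const w
      have h2 := (hF _ (ofReal_mul_mem_disc hw ht)).comp (t : ℂ) h1
      have h3 := h2.comp_ofReal
      rw [mul_comm] at h3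
      exact h3
    have := intervalIntegral.integral_eq_sub_of_hasDerivAt hder
      (continuousOn_segment hh hw).intervalIntegrable
    simpa [segmentIntegral] using this
  refine ((hF z hz).sub_const (F 0)).congr_of_eventuallyEq ?_
  filter_upwards [isOpen_ball.mem_nhds hz] with w hw using key w hw

lemma differentiableOn_integrand (n : ℕ) (ϕ g : HolDisc)
    (hϕ : MapsTo (ϕ : ℂ → ℂ) (ball 0 1) (ball 0 1)) (f : HolDisc) :
    DifferentiableOn ℂ (fun ξ => iteratedDeriv n (f : ℂ → ℂ) ((ϕ : ℂ → ℂ) ξ) * (g : ℂ → ℂ) ξ)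
      (ball 0 1) :=
  ((differentiableOn_iteratedDeriv_holDisc n f).comp ϕ.2.1 hϕ).mul g.2.1

/-- The generalized integration operator
`(C^n_{ϕ,g} f)(z) = ∫_0^z f^{(n)}(ϕ(ξ)) g(ξ) dξ` on `H(𝔻)`, for `g ∈ H(𝔻)` and an analytic
self-map `ϕ` of `𝔻`. -/
def genIntOp (n : ℕ) (ϕ g : HolDisc) (hϕ : MapsTo (ϕ : ℂ → ℂ) (ball 0 1) (ball 0 1)) :
    HolDisc →ₗ[ℂ] HolDisc where
  toFun f := ⟨(ball (0 : ℂ) 1).indicator (segmentIntegral fun ξ =>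
      iteratedDeriv n (f : ℂ → ℂ) ((ϕ : ℂ → ℂ) ξ) * (g : ℂ → ℂ) ξ), by
    refine ⟨DifferentiableOn.congr (fun z hz => (hasDerivAt_segmentIntegral
      (differentiableOn_integrand n ϕ g hϕ f) hz).differentiableAt.differentiableWithinAt)
      fun z hz => indicator_of_mem hz _, fun z hz => indicator_of_notMem hz _⟩⟩
  map_add' f₁ f₂ := by
    apply Subtype.ext
    ext z
    by_cases hz : z ∈ ball (0 : ℂ) 1
    · simp only [Submodule.coe_add, Pi.add_apply, indicator_of_mem hz, segmentIntegral]
      rw [← intervalIntegral.integral_add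
        (continuousOn_segment (differentiableOn_integrand n ϕ g hϕ f₁) hz).intervalIntegrable
        (continuousOn_segment (differentiableOn_integrand n ϕ g hϕ f₂) hz).intervalIntegrable]
      refine intervalIntegral.integral_congr fun t ht => ?_
      have hm := isOpen_ball.mem_nhds (hϕ (ofReal_mul_mem_disc hz ht))
      have h1 := ((f₁.2.1.contDiffOn isOpen_ball).contDiffAt hm (n := n))
      have h2 := ((f₂.2.1.contDiffOn isOpen_ball).contDiffAt hm (n := n))
      simp only [iteratedDeriv_add h1 h2]
      ring
    · simp [indicator_of_notMem hz]
  map_smul' c f := by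
    apply Subtype.ext
    ext z
    by_cases hz : z ∈ ball (0 : ℂ) 1
    · simp only [Submodule.coe_smul, Pi.smul_apply, indicator_of_mem hz, segmentIntegral,
        RingHom.id_apply, smul_eq_mul]
      rw [← intervalIntegral.integral_const_mul]
      refine intervalIntegral.integral_congr fun t ht => ?_
      simp only [iteratedDeriv_const_smul_field, smul_eq_mul]
      ring
    · simp [indicator_of_notMem hz]

/-! # Compactness -/

/-- `T` maps `H(p,q,φ)` into `ℬ_μ`. -/
def MapsMixedToBloch (p q : ℝ) (φ : ℝ → ℝ) (μ : DiscWeight) (T : HolDisc →ₗ[ℂ] HolDisc) : Prop :=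
  ∀ f ∈ mixedNormSpace p q φ, T f ∈ blochSubmodule μ

/-- The operator `T : H(p,q,φ) → ℬ_μ` obtained by restriction. -/
def mixedToBloch {p q : ℝ} {φ : ℝ → ℝ} {μ : DiscWeight} {T : HolDisc →ₗ[ℂ] HolDisc}
    (hT : MapsMixedToBloch p q φ μ T) (f : mixedNormSpace p q φ) : Bloch μ :=
  (⟨T f, hT f f.2⟩ : blochSubmodule μ)

/-- A map `H(p,q,φ) → ℬ_μ` is a compact operator if it sends every (quasi-)norm bounded set to a
relatively compact subset of the normed space `ℬ_μ`. -/
def IsCompactMixedToBloch {p q : ℝ} {φ : ℝ → ℝ} {μ : DiscWeight}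
    (S : mixedNormSpace p q φ → Bloch μ) : Prop :=
  ∀ R : ℝ≥0, IsCompact (closure (S '' {f | mixedNorm p q φ ((f : HolDisc) : ℂ → ℂ) ≤ R}))

/-- The filter `|ϕ(z)| → 1`, `z ∈ 𝔻`. It is trivial if `sup_𝔻 |ϕ| < 1`, and a `limsup` of
`[0,∞]`-valued functions along it is then `0`. -/
def normTendsToOne (ϕ : HolDisc) : Filter ℂ :=
  comap (fun z => ‖(ϕ : ℂ → ℂ) z‖) (𝓝 1) ⊓ 𝓟 (ball 0 1)

end

/-!
# Compactness of generalized integration operators `H(p,q,φ) → ℬ_μ`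

Since `(C^n_{ϕ,g} f)' = (f^{(n)} ∘ ϕ) g` and `(C^n_{ϕ,g} f)(0) = 0`, everything rests on how large
`f^{(n)}(ζ)` can be. For `‖f‖_{p,q,φ} ≤ R` it is at most `C R / (φ(|ζ|) (1 - |ζ|²)^{1/q + n})`
(`exists_iteratedDeriv_growth_bound`), and for `|ζ| ≥ 1/2` this is attained up to a constant,
by functions that tend to `0` pointwise, with their derivatives, as `|ζ| → 1`.

*Growth.* By Cauchy's estimate only `n = 0` matters. For an integer `m ≥ q`, Cauchy's formula for
`f ^ m` on `|ζ| = R` bounds `|f(z)| ^ m` by `(R - |z|)⁻¹ M_∞(f,R)^{m-q} M_q(f,R)^q`. Instead of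
removing the factor `M_∞` by subharmonicity of `|f|^q`, the maximum of
`|f(z)| (r₁ - |z|)^{1/p + 1/q}` over an annulus is considered: at the maximum point the factor
`M_∞` is controlled by the maximum itself, and integrating in `R` gives the bound for every
positive `p` and `q` (`norm_rpow_le_lintegral_integralMean`). On the annulus
`|z| ≤ R ≤ (1 + |z|) / 2` a normal function is at least a constant multiple of `φ(|z|)`.

*Sufficiency.* A bounded sequence in `H(p,q,φ)` has a locally uniformly convergent subsequence
(`exists_subseq_tendstoLocallyUniformlyOn`). Where `|ϕ(z)|` is close to `1`, the limsup condition
and the growth bound make the Bloch seminorm of the difference small; elsewhere locally uniform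
convergence of the `n`-th derivatives does, because `μ |g|` is bounded
(`exists_radial_mul_norm_le`).

*Necessity.* The test functions are
`f_w(z) = (1 - |w|²)^{N - 1/q} / (φ(|w|) (1 - w̄ z)^N)` with a large integer `N`. They are bounded in
`H(p,q,φ)` uniformly in `w` (`exists_mixedNorm_cauchyTest_le`), their `n`-th derivatives tend to `0`
pointwise as `|w| → 1`, and `f_w^{(n)}(w)` has the size of the growth bound. Taking `w = ϕ(z_k)`
with `|ϕ(z_k)| → 1`, compactness forces the images to tend to `0` in `ℬ_μ`, and evaluating at `z_k`
gives the limsup condition.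
-/

/-! ### Integral means and pointwise bounds -/

/-- Cauchy's formula on the circle of radius `R`, with the kernel replaced by its maximum. -/
lemma enorm_le_circle_lintegral {f : ℂ → ℂ} (hf : DifferentiableOn ℂ f (ball 0 1)) {R : ℝ}
    (hR : R < 1) {z : ℂ} (hz : ‖z‖ < R) :
    ‖f z‖ₑ ≤ ENNReal.ofReal (1 / (R - ‖z‖)) * (ENNReal.ofReal (1 / (2 * Real.pi)) *
      ∫⁻ θ in Ioc (0 : ℝ) (2 * Real.pi), ‖f (R * Complex.exp (θ * Complex.I))‖ₑ) := by
  have hR0 : 0 < R := (norm_nonneg z).trans_lt hz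
  have hd : DiffContOnCl ℂ f (ball 0 |R|) := by
    rw [abs_of_pos hR0]
    exact (hf.mono (closedBall_subset_ball hR)).diffContOnCl_ball (c := 0) subset_rfl
  have h := hd.circleAverage_smul_div (w := z) (by simpa [abs_of_pos hR0] using hz)
  rw [Real.circleAverage_def, intervalIntegral.integral_of_le Real.two_pi_pos.le] at h
  rw [← h, enorm_smul, Real.enorm_eq_ofReal (by positivity), ← one_div, mul_left_comm]
  gcongr
  rw [← lintegral_const_mul' _ _ ENNReal.ofReal_ne_top]
  refine (enorm_integral_le_lintegral_enorm _).trans (lintegral_mono fun θ => ?_)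
  rw [enorm_smul]
  have hc : circleMap 0 R θ = R * Complex.exp (θ * Complex.I) := by simp [circleMap]
  have hn : ‖circleMap 0 R θ‖ = R := by simp [abs_of_pos hR0]
  rw [← hc]
  gcongr
  rw [← ofReal_norm, norm_div, sub_zero, hn]
  refine ENNReal.ofReal_le_ofReal ?_
  have := norm_sub_norm_le (circleMap 0 R θ) z
  rw [hn] at this
  exact div_le_div₀ zero_le_one hR.le (by linarith) this

/-- Cauchy's formula for `f ^ m`, where all but `q` of the `m` factors are bounded by `B`. -/
lemma enorm_pow_le_integralMean {f : ℂ → ℂ} (hf : DifferentiableOn ℂ f (ball 0 1)) {q : ℝ}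
    (hq : 0 < q) {m : ℕ} (hm : q ≤ m) {R : ℝ} (hR : R < 1) {z : ℂ} (hz : ‖z‖ < R) {B : ℝ}
    (hB : ∀ ζ : ℂ, ‖ζ‖ = R → ‖f ζ‖ ≤ B) :
    ‖f z‖ₑ ^ (m : ℝ) ≤ ENNReal.ofReal (1 / (R - ‖z‖)) *
      (ENNReal.ofReal B ^ ((m : ℝ) - q) * integralMean q f R ^ q) := by
  have hR0 : 0 < R := (norm_nonneg z).trans_lt hz
  have h := enorm_le_circle_lintegral (hf.pow m) hR hz
  simp only [Pi.pow_apply, enorm_pow] at h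
  rw [ENNReal.rpow_natCast]
  refine h.trans (mul_le_mul_right ?_ _)
  rw [integralMean, one_div q, ENNReal.rpow_inv_rpow hq.ne', mul_left_comm]
  gcongr
  rw [← lintegral_const_mul' _ _ (ENNReal.rpow_ne_top_of_nonneg (by linarith)
    ENNReal.ofReal_ne_top)]
  refine lintegral_mono fun θ => ?_
  rw [← ENNReal.rpow_natCast]
  have : (m : ℝ) = ((m : ℝ) - q) + q := by ring
  nth_rw 1 [this]
  rw [ENNReal.rpow_add_of_nonneg _ _ (by linarith) hq.le]
  refine mul_le_mul_left (ENNReal.rpow_le_rpow ?_ (by linarith)) _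
  rw [← ofReal_norm]
  exact ENNReal.ofReal_le_ofReal (hB _ (by simp [Complex.norm_exp_ofReal_mul_I, abs_of_pos hR0]))

/-- The bound of `enorm_pow_le_integralMean`, integrated over the radii of an annulus. -/
lemma norm_rpow_le_of_annulus {f : ℂ → ℂ} (hf : DifferentiableOn ℂ f (ball 0 1)) {p q : ℝ}
    (hp : 0 < p) (hq : 0 < q) {m : ℕ} (hm : q ≤ m) {z : ℂ} {e B I : ℝ} (he : 0 < e)
    (hz : ‖z‖ + 3 * e < 1) (hB0 : 0 ≤ B) (hI0 : 0 ≤ I)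
    (hB : ∀ ζ : ℂ, ‖z‖ + e ≤ ‖ζ‖ → ‖ζ‖ ≤ ‖z‖ + 3 * e → ‖f ζ‖ ≤ B)
    (hI : ∫⁻ R in Icc (‖z‖ + e) (‖z‖ + 3 * e), integralMean q f R ^ p ≤ ENNReal.ofReal I) :
    ‖f z‖ ^ (m * (p / q)) * (2 * e) ≤ (1 / e) ^ (p / q) * B ^ ((m - q) * (p / q)) * I := by
  have hs : 0 < p / q := div_pos hp hq
  have key : ∀ R ∈ Icc (‖z‖ + e) (‖z‖ + 3 * e), ENNReal.ofReal (‖f z‖ ^ (m * (p / q))) ≤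
      ENNReal.ofReal ((1 / e) ^ (p / q) * B ^ ((m - q) * (p / q))) * integralMean q f R ^ p := by
    intro R hR
    have h := enorm_pow_le_integralMean hf hq hm (R := R) (by linarith [hR.2]) (z := z)
      (by linarith [hR.1]) (B := B) (fun ζ hζ => hB ζ (hζ ▸ hR.1) (hζ ▸ hR.2))
    have h2 : ENNReal.ofReal (1 / (R - ‖z‖)) ≤ ENNReal.ofReal (1 / e) :=
      ENNReal.ofReal_le_ofReal (one_div_le_one_div_of_le he (by linarith [hR.1]))
    have h3 := ENNReal.rpow_le_rpow (h.trans (mul_le_mul_left h2 _)) hs.le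
    rw [ENNReal.mul_rpow_of_nonneg _ _ hs.le, ENNReal.mul_rpow_of_nonneg _ _ hs.le,
      ← ENNReal.rpow_mul, ← ENNReal.rpow_mul, ← ENNReal.rpow_mul, mul_div_cancel₀ p hq.ne',
      ← ofReal_norm, ENNReal.ofReal_rpow_of_nonneg (norm_nonneg _) (by positivity),
      ENNReal.ofReal_rpow_of_nonneg (by positivity) hs.le,
      ENNReal.ofReal_rpow_of_nonneg hB0 (mul_nonneg (by linarith) hs.le), ← mul_assoc,
      ← ENNReal.ofReal_mul (by positivity)] at h3
    exact h3
  have h := setLIntegral_mono' (μ := volume) measurableSet_Icc key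
  rw [lintegral_const_mul' _ _ ENNReal.ofReal_ne_top, setLIntegral_const, Real.volume_Icc] at h
  have h4 := h.trans (mul_le_mul_right hI _)
  rw [← ENNReal.ofReal_mul (by positivity), ← ENNReal.ofReal_mul (by positivity),
    ENNReal.ofReal_le_ofReal_iff (by positivity)] at h4
  convert h4 using 2
  ring

/-- The integral means over an annulus control `f` on its inner boundary. The function
`‖f z‖ * (r₁ - ‖z‖) ^ (1 / p + 1 / q)` is estimated at its maximum point, in terms of its own
maximum and of the means; this replaces the subharmonicity of `‖f‖ ^ q`. -/
lemma norm_rpow_le_lintegral_integralMean {f : ℂ → ℂ} (hf : DifferentiableOn ℂ f (ball 0 1))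
    {p q : ℝ} (hp : 0 < p) (hq : 0 < q) {m : ℕ} (hm : q ≤ m) {z₀ : ℂ} {r₁ I : ℝ}
    (h01 : ‖z₀‖ < r₁) (hr₁ : r₁ < 1) (hI0 : 0 ≤ I)
    (hI : ∫⁻ R in Ico ‖z₀‖ r₁, integralMean q f R ^ p ≤ ENNReal.ofReal I) :
    ‖f z₀‖ ^ p * (r₁ - ‖z₀‖) ^ (1 + p / q) ≤ 4 ^ (m * (p / q) * (1 / p + 1 / q)) * I := by
  set γ : ℝ := 1 / p + 1 / q with hγ
  have hγ0 : 0 < γ := by positivity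
  set s : ℝ := p / q with hs
  have hs0 : 0 < s := div_pos hp hq
  have hm0 : (0 : ℝ) < m := hq.trans_le hm
  have hγp : γ * p = 1 + s := by rw [hγ, hs]; field_simp
  have hqs : q * s = p := by rw [hs]; field_simp
  set A : Set ℂ := {z | ‖z₀‖ ≤ ‖z‖ ∧ ‖z‖ ≤ r₁}
  have hA : IsCompact A := by
    refine (isCompact_closedBall (0 : ℂ) r₁).of_isClosed_subset ?_ fun z hz => by
      simpa using hz.2
    exact (isClosed_le continuous_const continuous_norm).inter
      (isClosed_le continuous_norm continuous_const)
  have hAf : ContinuousOn f A := hf.continuousOn.mono fun z hz => by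
    simpa using hz.2.trans_lt hr₁
  obtain ⟨z, hzA, hmax⟩ := hA.exists_isMaxOn (f := fun z => ‖f z‖ * (r₁ - ‖z‖) ^ γ)
    ⟨z₀, le_rfl, h01.le⟩ (hAf.norm.mul (ContinuousOn.rpow_const (by fun_prop)
      fun _ _ => Or.inr hγ0.le))
  set K := ‖f z‖ * (r₁ - ‖z‖) ^ γ with hK
  have hmax' : ∀ ζ ∈ A, ‖f ζ‖ * (r₁ - ‖ζ‖) ^ γ ≤ K := fun ζ hζ => hmax hζ
  have hK0 : 0 ≤ K := mul_nonneg (norm_nonneg _) (Real.rpow_nonneg (by linarith [hzA.2]) _)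
  suffices h : K ^ p ≤ 4 ^ (m * s * γ) * I by
    have h1 := Real.rpow_le_rpow (by positivity [sub_nonneg.2 h01.le])
      (hmax' z₀ ⟨le_rfl, h01.le⟩) hp.le
    rw [Real.mul_rpow (norm_nonneg _) (Real.rpow_nonneg (by linarith) _), ← Real.rpow_mul
      (by linarith), hγp] at h1
    exact h1.trans h
  rcases hK0.eq_or_lt with hK' | hK'
  · rw [← hK', Real.zero_rpow hp.ne']
    positivity
  have hzr : ‖z‖ < r₁ := by
    refine lt_of_le_of_ne hzA.2 fun h => hK'.ne' ?_
    rw [hK, h, sub_self, Real.zero_rpow hγ0.ne', mul_zero]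
  obtain ⟨e, he⟩ : ∃ e, e = (r₁ - ‖z‖) / 4 := ⟨_, rfl⟩
  have he0 : 0 < e := by rw [he]; linarith
  have hre : r₁ - ‖z‖ = 4 * e := by rw [he]; ring
  have h := norm_rpow_le_of_annulus hf hp hq hm (z := z) (e := e) (B := K / e ^ γ) (I := I) he0
    (by linarith) (by positivity) hI0 ?_ ?_
  · have h2 : ‖f z‖ * e ^ γ = K / 4 ^ γ := by
      rw [hK, hre, Real.mul_rpow (by norm_num) he0.le]
      field_simp
    -- The choice of `γ` makes all powers of `e` but one cancel.
    have hexp : (1 / e) ^ s * (K / e ^ γ) ^ ((m - q) * s) * (e ^ γ) ^ (m * s) =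
        K ^ ((m - q) * s) * e := by
      rw [Real.div_rpow hK0 (by positivity), one_div, Real.inv_rpow he0.le,
        ← Real.rpow_mul he0.le, ← Real.rpow_mul he0.le, ← Real.rpow_neg he0.le, div_eq_mul_inv,
        ← Real.rpow_neg he0.le]
      have : e ^ (-s) * (K ^ ((m - q) * s) * e ^ (-(γ * ((m - q) * s)))) * e ^ (γ * (m * s)) =
        K ^ ((m - q) * s) * (e ^ (-s) * e ^ (-(γ * ((m - q) * s))) * e ^ (γ * (m * s))) := by ring
      rw [this, ← Real.rpow_add he0, ← Real.rpow_add he0]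
      have : -s + -(γ * ((m - q) * s)) + γ * (m * s) = 1 := by
        have : γ * (q * s) = 1 + s := by rw [hqs, hγp]
        linarith
      rw [this, Real.rpow_one]
    have h3 := mul_le_mul_of_nonneg_right h (show 0 ≤ (e ^ γ) ^ (m * s) by positivity)
    have h4 : ‖f z‖ ^ (m * s) * (2 * e) * (e ^ γ) ^ (m * s) = (K / 4 ^ γ) ^ (m * s) * (2 * e) := by
      rw [← h2, Real.mul_rpow (norm_nonneg _) (by positivity)]
      ring
    have h5 : (1 / e) ^ s * (K / e ^ γ) ^ ((m - q) * s) * I * (e ^ γ) ^ (m * s) =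
        K ^ ((m - q) * s) * e * I := by
      rw [← hexp]; ring
    rw [h4, h5, Real.div_rpow hK0 (by positivity), ← Real.rpow_mul (by norm_num)] at h3
    have h6 : K ^ (m * s) = K ^ ((m - q) * s) * K ^ p := by
      rw [← Real.rpow_add hK']
      congr 1
      rw [← hqs]; ring
    have hKs : 0 < K ^ ((m - q) * s) := by positivity
    have h4p : (0 : ℝ) < 4 ^ (γ * (m * s)) := by positivity
    rw [h6, div_mul_eq_mul_div, div_le_iff₀ h4p] at h3
    have h7 : (K ^ ((m - q) * s) * e) * (2 * K ^ p) ≤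
        (K ^ ((m - q) * s) * e) * (I * 4 ^ (γ * (m * s))) := by linarith
    have h8 := le_of_mul_le_mul_left h7 (by positivity)
    have : K ^ p ≤ 2 * K ^ p := by linarith [Real.rpow_nonneg hK0 p]
    rw [show (m * s * γ : ℝ) = γ * (m * s) by ring, mul_comm]
    exact this.trans h8
  · intro ζ h1 h2
    have hζ := hmax' ζ ⟨hzA.1.trans (by linarith), by linarith⟩
    rw [le_div_iff₀ (by positivity)]
    refine le_trans ?_ hζ
    gcongr
    linarith
  · refine (lintegral_mono_set ?_).trans hI
    exact fun R hR => ⟨by linarith [hR.1, hzA.1], by linarith [hR.2]⟩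

/-! ### Growth of functions in mixed-norm spaces -/

namespace IsNormalFunction

variable {φ : ℝ → ℝ}

/-- A normal function decreases at most by a constant factor from `r` to any radius up to
`(1 + r) / 2`. -/
lemma exists_le_mul (hφ : IsNormalFunction φ) : ∃ c : ℝ, 0 < c ∧ ∀ r s : ℝ, 0 ≤ r → r < 1 →
    0 ≤ s → s ≤ (1 + r) / 2 → c * φ r ≤ φ s := by
  obtain ⟨a, b, ha, hab, hanti, -, hmono, -⟩ := hφ.exists_exponents
  refine ⟨2 ^ (-b), by positivity, fun r s hr0 hr1 hs0 hs => ?_⟩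
  have hs1 : s < 1 := by linarith
  have hr := hφ.pos r ⟨hr0, hr1⟩
  have hrp : 0 < 1 - r := by linarith
  have hsp : 0 < 1 - s := by linarith
  have h2 : (2 : ℝ) ^ (-b) ≤ 1 := Real.rpow_le_one_of_one_le_of_nonpos one_le_two (by linarith)
  rcases le_total s r with h | h
  · have h1 := hanti ⟨hs0, hs1⟩ ⟨hr0, hr1⟩ h
    have h3 : (1 - r) ^ a ≤ (1 - s) ^ a := by gcongr
    rw [div_le_div_iff₀ (by positivity) (by positivity)] at h1
    have h4 : φ r * (1 - r) ^ a ≤ φ r * (1 - s) ^ a := by gcongr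
    have h5 := le_of_mul_le_mul_right (h4.trans h1) (by positivity)
    exact (mul_le_of_le_one_left hr.le h2).trans h5
  · have h1 := hmono ⟨hr0, hr1⟩ ⟨hs0, hs1⟩ h
    have h3 : ((1 - r) / 2) ^ b ≤ (1 - s) ^ b := by gcongr <;> linarith
    rw [Real.div_rpow hrp.le (by norm_num), div_eq_inv_mul, ← Real.rpow_neg (by norm_num)] at h3
    rw [div_le_div_iff₀ (by positivity) (by positivity)] at h1
    have h4 : φ r * (2 ^ (-b) * (1 - r) ^ b) ≤ φ r * (1 - s) ^ b := by gcongr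
    have h5 : (2 ^ (-b) * φ r) * (1 - r) ^ b ≤ φ s * (1 - r) ^ b := by linarith
    exact le_of_mul_le_mul_right h5 (by positivity)

end IsNormalFunction

/-- The growth of a function in `H(p,q,φ)`. -/
lemma exists_growth_bound {p q : ℝ} (hp : 0 < p) (hq : 0 < q) {φ : ℝ → ℝ}
    (hφ : IsNormalFunction φ) : ∃ C : ℝ, 0 < C ∧ ∀ (f : ℂ → ℂ) (R : ℝ≥0),
      DifferentiableOn ℂ f (ball 0 1) → mixedNorm p q φ f ≤ R → ∀ z ∈ ball (0 : ℂ) 1,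
      ‖f z‖ ≤ C * R / (φ ‖z‖ * (1 - ‖z‖) ^ (1 / q)) := by
  obtain ⟨c, hc, hle⟩ := hφ.exists_le_mul
  obtain ⟨m, hm⟩ := exists_nat_ge q
  set s : ℝ := p / q with hs
  set D : ℝ := 4 ^ (m * (p / q) * (1 / p + 1 / q)) with hD
  have hD0 : 0 < D := by positivity
  refine ⟨(D * 2 ^ (1 + s) * (1 / c ^ p)) ^ (1 / p), by positivity, fun f R hf hR z hz => ?_⟩
  have hz1 : ‖z‖ < 1 := by simpa using hz
  have hz0 := norm_nonneg z
  have hzp : 0 < 1 - ‖z‖ := by linarith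
  have hφz := hφ.pos ‖z‖ ⟨hz0, hz1⟩
  set w : ℝ := (c * φ ‖z‖) ^ p / (1 - ‖z‖) with hw
  have hw0 : 0 < w := by positivity
  -- The weight is at least `w` for the radii between `‖z‖` and `(1 + ‖z‖) / 2`.
  have hint : ENNReal.ofReal w * ∫⁻ r in Ico ‖z‖ ((1 + ‖z‖) / 2), integralMean q f r ^ p ≤
      (R : ℝ≥0∞) ^ p := by
    have h1 : mixedNorm p q φ f ^ p ≤ (R : ℝ≥0∞) ^ p := ENNReal.rpow_le_rpow hR hp.le
    rw [mixedNorm, one_div, ENNReal.rpow_inv_rpow hp.ne'] at h1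
    refine le_trans ?_ h1
    rw [← lintegral_const_mul' _ _ ENNReal.ofReal_ne_top]
    refine le_trans (setLIntegral_mono' measurableSet_Ico (g := fun r =>
      integralMean q f r ^ p * ENNReal.ofReal (φ r ^ p / (1 - r))) fun r hr => ?_) ?_
    · rw [mul_comm]
      gcongr
      have hr1 : r < 1 := by linarith [hr.2]
      have := hle ‖z‖ r hz0 hz1 (hz0.trans hr.1) hr.2.le
      rw [hw]
      have h1r : 0 < 1 - r := by linarith
      exact div_le_div₀ (by have := hφ.pos r ⟨hz0.trans hr.1, hr1⟩; positivity)
        (Real.rpow_le_rpow (by positivity) this hp.le) h1r (by linarith [hr.1])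
    · rw [setLIntegral_congr Ioo_ae_eq_Ico.symm]
      exact lintegral_mono_set fun r hr => ⟨hz0.trans_lt hr.1, by linarith [hr.2]⟩
  have hint' : ∫⁻ r in Ico ‖z‖ ((1 + ‖z‖) / 2), integralMean q f r ^ p ≤
      ENNReal.ofReal ((R : ℝ) ^ p / w) := by
    rw [ENNReal.ofReal_div_of_pos hw0, ← ENNReal.ofReal_rpow_of_nonneg R.coe_nonneg hp.le,
      ENNReal.ofReal_coe_nnreal, ENNReal.le_div_iff_mul_le
        (Or.inl (by simpa using hw0)) (Or.inl ENNReal.ofReal_ne_top), mul_comm]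
    exact hint
  have h := norm_rpow_le_lintegral_integralMean hf hp hq hm (by linarith) (by linarith)
    (by positivity) hint'
  rw [← hD, ← hs, show (1 + ‖z‖) / 2 - ‖z‖ = (1 - ‖z‖) / 2 by ring,
    Real.div_rpow hzp.le (by norm_num), Real.rpow_add hzp, Real.rpow_one, hw,
    Real.mul_rpow hc.le hφz.le] at h
  rw [← Real.rpow_le_rpow_iff (norm_nonneg _) (by positivity) hp,
    Real.div_rpow (by positivity) (by positivity), Real.mul_rpow (by positivity) (by positivity),
    Real.mul_rpow hφz.le (by positivity), ← Real.rpow_mul (by positivity),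
    ← Real.rpow_mul (by positivity), one_div_mul_cancel hp.ne', Real.rpow_one,
    show 1 / q * p = s by rw [hs]; ring, le_div_iff₀ (by positivity)]
  have h2 : 0 < (2 : ℝ) ^ (1 + s) := by positivity
  have hφp : 0 < φ ‖z‖ ^ p := by positivity
  have hcp : 0 < c ^ p := by positivity
  have hX : D * (R ^ p / (c ^ p * φ ‖z‖ ^ p / (1 - ‖z‖))) =
    (D * R ^ p / (c ^ p * φ ‖z‖ ^ p)) * (1 - ‖z‖) := by field_simp
  have hY : ‖f z‖ ^ p * ((1 - ‖z‖) * (1 - ‖z‖) ^ s / 2 ^ (1 + s)) =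
    (‖f z‖ ^ p * (1 - ‖z‖) ^ s / 2 ^ (1 + s)) * (1 - ‖z‖) := by ring
  rw [hX, hY] at h
  have h3 := le_of_mul_le_mul_right h hzp
  rw [div_le_div_iff₀ h2 (by positivity)] at h3
  have h4 : D * 2 ^ (1 + s) * (1 / c ^ p) * R ^ p = D * R ^ p * 2 ^ (1 + s) / c ^ p := by
    field_simp
  rw [h4, le_div_iff₀ hcp]
  linarith

/-- The growth of the `n`-th derivative of a function in `H(p,q,φ)`. -/
lemma exists_iteratedDeriv_growth_bound (n : ℕ) {p q : ℝ} (hp : 0 < p) (hq : 0 < q) {φ : ℝ → ℝ}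
    (hφ : IsNormalFunction φ) : ∃ C : ℝ, 0 < C ∧ ∀ (f : ℂ → ℂ) (R : ℝ≥0),
      DifferentiableOn ℂ f (ball 0 1) → mixedNorm p q φ f ≤ R → ∀ z ∈ ball (0 : ℂ) 1,
      ‖iteratedDeriv n f z‖ ≤ C * R / (φ ‖z‖ * (1 - ‖z‖ ^ 2) ^ (1 / q + n)) := by
  obtain ⟨C, hC, hb⟩ := exists_growth_bound hp hq hφ
  obtain ⟨c, hc, hle⟩ := hφ.exists_le_mul
  refine ⟨n.factorial * (C / c) * 2 ^ (1 / q + n) * 2 ^ (1 / q + n), by positivity,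
    fun f R hf hR z hz => ?_⟩
  have hz1 : ‖z‖ < 1 := by simpa using hz
  have hz0 := norm_nonneg z
  have hzp : 0 < 1 - ‖z‖ := by linarith
  have hφz := hφ.pos ‖z‖ ⟨hz0, hz1⟩
  set ρ : ℝ := (1 - ‖z‖) / 2 with hρ
  have hρ0 : 0 < ρ := by positivity
  have hsub : closedBall z ρ ⊆ ball 0 1 := fun ζ hζ => by
    have h1 : ‖ζ - z‖ ≤ ρ := by simpa [dist_eq_norm] using hζ
    have h2 := norm_sub_norm_le ζ z
    simp only [mem_ball_zero_iff]
    linarith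
  have h := Complex.norm_iteratedDeriv_le_of_forall_mem_sphere_norm_le (c := z) n hρ0
    (C := C * R / (c * φ ‖z‖ * ρ ^ (1 / q)))
    ((hf.mono hsub).diffContOnCl_ball subset_rfl) (fun ζ hζ => by
      have h1 : ‖ζ - z‖ = ρ := by simpa [dist_eq_norm] using hζ
      have h2 := norm_sub_norm_le ζ z
      have h3 := hle ‖z‖ ‖ζ‖ hz0 hz1 (norm_nonneg _) (by linarith)
      have h4 := mem_ball_zero_iff.1 (hsub (sphere_subset_closedBall hζ))
      have h5 := hφ.pos ‖ζ‖ ⟨norm_nonneg _, h4⟩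
      refine (hb f R hf hR ζ (hsub (sphere_subset_closedBall hζ))).trans ?_
      gcongr
      linarith)
  refine h.trans ?_
  have hn : 0 < 1 - ‖z‖ ^ 2 := by nlinarith
  rw [le_div_iff₀ (by positivity)]
  have h5 : (1 - ‖z‖ ^ 2) ^ (1 / q + (n : ℝ)) ≤
      2 ^ (1 / q + (n : ℝ)) * 2 ^ (1 / q + (n : ℝ)) * (ρ ^ (1 / q) * ρ ^ n) := by
    rw [← Real.rpow_natCast ρ n, ← Real.rpow_add hρ0, ← Real.mul_rpow (by norm_num) (by norm_num),
      ← Real.mul_rpow (by norm_num) hρ0.le]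
    refine Real.rpow_le_rpow hn.le ?_ (by positivity)
    nlinarith
  calc n.factorial * (C * R / (c * φ ‖z‖ * ρ ^ (1 / q))) / ρ ^ n *
        (φ ‖z‖ * (1 - ‖z‖ ^ 2) ^ (1 / q + (n : ℝ)))
      ≤ n.factorial * (C * R / (c * φ ‖z‖ * ρ ^ (1 / q))) / ρ ^ n * (φ ‖z‖ *
        (2 ^ (1 / q + (n : ℝ)) * 2 ^ (1 / q + (n : ℝ)) * (ρ ^ (1 / q) * ρ ^ n))) := by gcongr
    _ = _ := by field_simp

/-! ### Normal families -/

lemma exists_bound_taylorCoeff {f : ℂ → ℂ} (hf : DifferentiableOn ℂ f (ball 0 1)) {r M : ℝ}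
    (hr0 : 0 < r) (hr1 : r < 1) (hM : ∀ z : ℂ, ‖z‖ ≤ r → ‖f z‖ ≤ M) (j : ℕ) :
    ‖iteratedDeriv j f 0 / j.factorial‖ ≤ M / r ^ j := by
  have h := Complex.norm_iteratedDeriv_le_of_forall_mem_sphere_norm_le (c := 0) j hr0 (C := M)
    ((hf.mono (closedBall_subset_ball hr1)).diffContOnCl_ball subset_rfl)
    (fun z hz => hM z (by simpa using (mem_sphere_zero_iff_norm.1 hz).le))
  rw [norm_div, Complex.norm_natCast, div_le_iff₀ (by positivity)]
  exact h.trans_eq (by ring)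

/-- **Montel's theorem** on the unit disc, for sequences. -/
lemma exists_subseq_tendstoLocallyUniformlyOn {F : ℕ → ℂ → ℂ}
    (hF : ∀ k, DifferentiableOn ℂ (F k) (ball 0 1)) {M : ℝ → ℝ}
    (hM : ∀ k, ∀ r < 1, ∀ z : ℂ, ‖z‖ ≤ r → ‖F k z‖ ≤ M r) :
    ∃ (f : ℂ → ℂ) (s : ℕ → ℕ), StrictMono s ∧ DifferentiableOn ℂ f (ball 0 1) ∧
      TendstoLocallyUniformlyOn (fun k => F (s k)) f atTop (ball 0 1) := by
  set a : ℕ → ℕ → ℂ := fun k j => iteratedDeriv j (F k) 0 / j.factorial with ha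
  have hab : ∀ r, 0 < r → r < 1 → ∀ k j, ‖a k j‖ ≤ M r / r ^ j := fun r h0 h1 k j =>
    exists_bound_taylorCoeff (hF k) h0 h1 (hM k r h1) j
  have hcpt : IsCompact (Set.pi univ fun j => closedBall (0 : ℂ) (M (1 / 2) / (1 / 2) ^ j)) :=
    isCompact_univ_pi fun j => isCompact_closedBall _ _
  obtain ⟨c, -, s, hs, hlim⟩ := hcpt.isSeqCompact (x := a) fun k j _ => by
    simpa using hab (1 / 2) (by norm_num) (by norm_num) k j
  rw [tendsto_pi_nhds] at hlim
  have hcb : ∀ r, 0 < r → r < 1 → ∀ j, ‖c j‖ ≤ M r / r ^ j := fun r h0 h1 j =>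
    le_of_tendsto (hlim j).norm (Eventually.of_forall fun k => hab r h0 h1 _ j)
  -- On `‖z‖ ≤ r < ρ < 1` both power series are dominated by a geometric series of ratio `r / ρ`.
  have key : ∀ r, 0 < r → r < 1 → TendstoUniformlyOn (fun k => F (s k))
      (fun z => ∑' j, c j * z ^ j) atTop (closedBall 0 r) := by
    intro r hr0 hr1
    obtain ⟨ρ, hrρ, hρ1⟩ := exists_between hr1
    have hρ0 := hr0.trans hrρ
    have hgeo : Summable fun j : ℕ => 2 * M ρ * (r / ρ) ^ j :=
      (summable_geometric_of_lt_one (by positivity) ((div_lt_one hρ0).2 hrρ)).mul_left _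
    have hbd : ∀ x : ℂ, ∀ j : ℕ, ‖x‖ ≤ M ρ / ρ ^ j → ‖x‖ * r ^ j ≤ M ρ * (r / ρ) ^ j := by
      intro x j hx
      calc ‖x‖ * r ^ j ≤ M ρ / ρ ^ j * r ^ j := by gcongr
        _ = _ := by rw [div_pow]; ring
    have hdiff : ∀ k j, ‖a (s k) j - c j‖ * r ^ j ≤ 2 * M ρ * (r / ρ) ^ j := by
      intro k j
      have h1 := hbd _ j (hab ρ hρ0 hρ1 (s k) j)
      have h2 := hbd _ j (hcb ρ hρ0 hρ1 j)
      have h3 := mul_le_mul_of_nonneg_right (norm_sub_le (a (s k) j) (c j))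
        (show 0 ≤ r ^ j by positivity)
      linarith
    have hsum : Tendsto (fun k => ∑' j, ‖a (s k) j - c j‖ * r ^ j) atTop (𝓝 0) := by
      have := tendsto_tsum_of_dominated_convergence (𝓕 := atTop)
        (f := fun k j => ‖a (s k) j - c j‖ * r ^ j) (g := fun _ => (0 : ℝ)) hgeo
        (fun j => by
          have := ((hlim j).sub_const (c j)).norm.mul_const (r ^ j)
          simpa using this)
        (Eventually.of_forall fun k j => by
          rw [Real.norm_of_nonneg (by positivity)]
          exact hdiff k j)
      simpa using this
    rw [Metric.tendstoUniformlyOn_iff]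
    intro ε hε
    filter_upwards [hsum.eventually_lt_const hε] with k hk z hz
    have hzr : ‖z‖ ≤ r := by simpa using hz
    have hc : Summable fun j => c j * z ^ j := by
      refine Summable.of_norm_bounded (hgeo.mul_left (1 / 2)) fun j => ?_
      rw [norm_mul, norm_pow]
      have h1 := hbd _ j (hcb ρ hρ0 hρ1 j)
      have h2 : ‖c j‖ * ‖z‖ ^ j ≤ ‖c j‖ * r ^ j := by gcongr
      linarith
    have hfz := Complex.hasSum_taylorSeries_on_ball (hF (s k)) (z := z)
      (by simpa using hzr.trans_lt hr1)
    have he : (fun j : ℕ => (j.factorial : ℂ)⁻¹ • (z - 0) ^ j • iteratedDeriv j (F (s k)) 0) =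
        fun j => a (s k) j * z ^ j := by
      funext j
      simp only [ha, smul_eq_mul, sub_zero]
      ring
    rw [he] at hfz
    have hd : Summable fun j => ‖a (s k) j - c j‖ * r ^ j :=
      Summable.of_nonneg_of_le (fun j => by positivity) (hdiff k) hgeo
    rw [dist_comm, dist_eq_norm]
    rw [← (hfz.sub hc.hasSum).tsum_eq]
    refine lt_of_le_of_lt (tsum_of_norm_bounded hd.hasSum fun j => ?_) hk
    rw [← sub_mul, norm_mul, norm_pow]
    gcongr
  have hloc : TendstoLocallyUniformlyOn (fun k => F (s k)) (fun z => ∑' j, c j * z ^ j) atTop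
      (ball 0 1) := by
    refine tendstoLocallyUniformlyOn_of_forall_exists_nhds fun z hz => ?_
    have hz1 : ‖z‖ < 1 := by simpa using hz
    obtain ⟨r, hzr, hr1⟩ := exists_between hz1
    refine ⟨closedBall 0 r, mem_nhdsWithin_of_mem_nhds (mem_of_superset
      (isOpen_ball.mem_nhds (by simpa using hzr)) ball_subset_closedBall),
      key r ((norm_nonneg z).trans_lt hzr) hr1⟩
  exact ⟨_, s, hs, hloc.differentiableOn (Eventually.of_forall fun k => hF (s k)) isOpen_ball,
    hloc⟩

lemma tendstoLocallyUniformlyOn_iteratedDeriv {F : ℕ → ℂ → ℂ} {f : ℂ → ℂ} {U : Set ℂ}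
    (hU : IsOpen U) (hF : ∀ k, DifferentiableOn ℂ (F k) U)
    (h : TendstoLocallyUniformlyOn F f atTop U) (n : ℕ) :
    TendstoLocallyUniformlyOn (fun k => iteratedDeriv n (F k)) (iteratedDeriv n f) atTop U := by
  suffices (∀ k, DifferentiableOn ℂ (iteratedDeriv n (F k)) U) ∧ TendstoLocallyUniformlyOn
      (fun k => iteratedDeriv n (F k)) (iteratedDeriv n f) atTop U from this.2
  induction n with
  | zero => simpa using ⟨hF, h⟩
  | succ n ih =>
    simp only [iteratedDeriv_succ]
    exact ⟨fun k => (ih.1 k).deriv hU, ih.2.deriv (Eventually.of_forall ih.1) hU⟩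

/-! ### Integral means of the Cauchy kernel and mixed norms -/

lemma lintegral_one_sub_rpow {e u v : ℝ} (huv : u ≤ v)
    (h : 0 < e ∧ v ≤ 1 ∨ e < 0 ∧ v < 1) :
    ∫⁻ r in Ioo u v, ENNReal.ofReal ((1 - r) ^ (e - 1)) =
      ENNReal.ofReal (((1 - u) ^ e - (1 - v) ^ e) / e) := by
  have hv : v ≤ 1 := h.elim And.right fun h => h.2.le
  have h0 : -1 < e - 1 ∨ e - 1 ≠ -1 ∧ (0 : ℝ) ∉ uIcc (1 - v) (1 - u) := by
    rcases h with h | h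
    · left; linarith
    · right
      refine ⟨by linarith, fun hm => ?_⟩
      rw [uIcc_of_le (by linarith)] at hm
      linarith [hm.1]
  have hint : IntervalIntegrable (fun x : ℝ => x ^ (e - 1)) volume (1 - v) (1 - u) :=
    h0.elim (fun h => intervalIntegral.intervalIntegrable_rpow' h)
      fun h => intervalIntegral.intervalIntegrable_rpow (Or.inr h.2)
  have hint' : IntervalIntegrable (fun r : ℝ => (1 - r) ^ (e - 1)) volume u v := by
    simpa using (hint.comp_sub_left 1).symm
  rw [setLIntegral_congr Ioo_ae_eq_Ioc, ← ofReal_integral_eq_lintegral_ofReal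
    ((intervalIntegrable_iff_integrableOn_Ioc_of_le huv).1 hint'),
    ← intervalIntegral.integral_of_le huv,
    intervalIntegral.integral_comp_sub_left (fun x : ℝ => x ^ (e - 1)) 1, integral_rpow h0,
    sub_add_cancel]
  filter_upwards [ae_restrict_mem measurableSet_Ioc] with r hr
  exact Real.rpow_nonneg (by linarith [hr.2]) _

/-- The Poisson kernel has mean value one, hence the square of the Cauchy kernel has mean
`1 / (1 - ‖c‖ ^ 2)`. -/
lemma lintegral_inv_norm_one_sub_sq {c : ℂ} (hc : ‖c‖ < 1) :
    ENNReal.ofReal (1 / (2 * Real.pi)) * ∫⁻ θ in Ioc (0 : ℝ) (2 * Real.pi),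
      ENNReal.ofReal (1 / ‖1 - c * Complex.exp (θ * Complex.I)‖ ^ 2) =
      ENNReal.ofReal (1 / (1 - ‖c‖ ^ 2)) := by
  have h := (differentiable_const (1 : ℂ)).diffContOnCl (s := ball (0 : ℂ) 1)
    |>.circleAverage_poissonKernel_smul' (w := starRingEnd ℂ c) (by simpa using hc)
  have hc2 : 0 < 1 - ‖c‖ ^ 2 := by nlinarith [norm_nonneg c]
  have hne : ∀ θ : ℝ, 0 < ‖1 - c * Complex.exp (θ * Complex.I)‖ := fun θ => by
    have h1 := norm_sub_norm_le (1 : ℂ) (c * Complex.exp (θ * Complex.I))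
    rw [norm_mul, Complex.norm_exp_ofReal_mul_I, mul_one, norm_one] at h1
    linarith
  have hcont : Continuous fun θ : ℝ => 1 / ‖1 - c * Complex.exp (θ * Complex.I)‖ ^ 2 := by
    refine continuous_const.div (by fun_prop) fun θ => by have := hne θ; positivity
  have hint : ∫ θ in Ioc (0 : ℝ) (2 * Real.pi), 1 / ‖1 - c * Complex.exp (θ * Complex.I)‖ ^ 2 =
      2 * Real.pi / (1 - ‖c‖ ^ 2) := by
    rw [Real.circleAverage_def, intervalIntegral.integral_of_le Real.two_pi_pos.le] at h
    have h1 : ∀ θ : ℝ, ((‖circleMap 0 1 θ - 0‖ ^ 2 - ‖starRingEnd ℂ c - 0‖ ^ 2) /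
        ‖circleMap 0 1 θ - 0 - (starRingEnd ℂ c - 0)‖ ^ 2) • (1 : ℂ) =
        (((1 - ‖c‖ ^ 2) * (1 / ‖1 - c * Complex.exp (θ * Complex.I)‖ ^ 2) : ℝ) : ℂ) := by
      intro θ
      have h2 : ‖circleMap 0 1 θ - starRingEnd ℂ c‖ =
          ‖1 - c * Complex.exp (θ * Complex.I)‖ := by
        have h3 : circleMap 0 1 θ - starRingEnd ℂ c = Complex.exp (θ * Complex.I) *
            starRingEnd ℂ (1 - c * Complex.exp (θ * Complex.I)) := by
          have h4 : Complex.exp (θ * Complex.I) * starRingEnd ℂ (Complex.exp (θ * Complex.I)) =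
              1 := by
            rw [Complex.mul_conj, Complex.normSq_eq_norm_sq, Complex.norm_exp_ofReal_mul_I]
            simp
          simp only [circleMap, map_sub, map_one, map_mul, Complex.ofReal_one, one_mul, zero_add]
          linear_combination (starRingEnd ℂ c) * h4
        rw [h3, norm_mul, Complex.norm_exp_ofReal_mul_I, one_mul, RCLike.norm_conj]
      simp only [sub_zero, h2, norm_circleMap_zero, RCLike.norm_conj, abs_one, one_pow,
        Complex.real_smul, mul_one]
      congr 1
      ring
    simp only [h1] at h
    rw [integral_complex_ofReal, integral_const_mul, Complex.real_smul, ← Complex.ofReal_mul] at h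
    have h2 := Complex.ofReal_injective (h.trans Complex.ofReal_one.symm)
    have := Real.pi_pos
    rw [eq_div_iff hc2.ne']
    field_simp at h2
    linarith
  rw [← ofReal_integral_eq_lintegral_ofReal (hcont.integrableOn_Ioc)
    (Eventually.of_forall fun θ => by positivity), hint, ← ENNReal.ofReal_mul (by positivity)]
  congr 1
  have := Real.pi_pos
  field_simp

/-- The integral means of a power of the Cauchy kernel of exponent `N ≥ 2 / q`. -/
lemma integralMean_cauchyKernel_le {q : ℝ} (hq : 0 < q) {N : ℕ} (hN : 2 ≤ N * q) {A : ℝ}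
    (hA : 0 ≤ A) {w : ℂ} (hw : ‖w‖ < 1) {f : ℂ → ℂ}
    (hf : ∀ z ∈ ball (0 : ℂ) 1, f z = A * ((1 - w * z) ^ N)⁻¹) {r : ℝ} (hr0 : 0 < r)
    (hr1 : r < 1) :
    integralMean q f r ≤ ENNReal.ofReal (A * (1 - ‖w‖ * r) ^ (-(N - 1 / q))) := by
  have hwr : ‖w‖ * r < 1 := by nlinarith [norm_nonneg w]
  have hx : 0 < 1 - ‖w‖ * r := by linarith
  have hnc : ‖w * r‖ = ‖w‖ * r := by simp [abs_of_pos hr0]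
  have key : ∀ θ : ℝ, ‖f (r * Complex.exp (θ * Complex.I))‖ₑ ^ q ≤
      ENNReal.ofReal (A ^ q * (1 - ‖w‖ * r) ^ (-(N * q - 2))) *
        ENNReal.ofReal (1 / ‖1 - w * r * Complex.exp (θ * Complex.I)‖ ^ 2) := by
    intro θ
    have hn : 1 - ‖w‖ * r ≤ ‖1 - w * r * Complex.exp (θ * Complex.I)‖ := by
      have h1 := norm_sub_norm_le (1 : ℂ) (w * r * Complex.exp (θ * Complex.I))
      rwa [norm_mul, hnc, Complex.norm_exp_ofReal_mul_I, mul_one, norm_one] at h1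
    set x := ‖1 - w * r * Complex.exp (θ * Complex.I)‖ with hxdef
    have hx0 : 0 < x := hx.trans_le hn
    rw [hf _ (by simpa [Complex.norm_exp_ofReal_mul_I, abs_of_pos hr0] using hr1), ← ofReal_norm,
      ← mul_assoc, norm_mul, norm_inv, norm_pow, ← hxdef, Complex.norm_real,
      Real.norm_of_nonneg hA, ENNReal.ofReal_rpow_of_nonneg (by positivity) hq.le,
      ← ENNReal.ofReal_mul (by positivity)]
    refine ENNReal.ofReal_le_ofReal ?_
    rw [Real.mul_rpow hA (by positivity), mul_assoc]
    gcongr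
    -- Two of the `N q` powers are kept for the Poisson kernel, the others are bounded.
    rw [← Real.rpow_natCast x N, ← Real.rpow_neg hx0.le, ← Real.rpow_mul hx0.le, one_div,
      ← Real.rpow_natCast x 2, ← Real.rpow_neg hx0.le]
    have h3 : x ^ (-(N * q - 2)) ≤ (1 - ‖w‖ * r) ^ (-(N * q - 2)) :=
      Real.rpow_le_rpow_of_nonpos hx hn (by linarith)
    calc x ^ (-(N : ℝ) * q) = x ^ (-(N * q - 2)) * x ^ (-((2 : ℕ) : ℝ)) := by
          rw [← Real.rpow_add hx0]; congr 1; push_cast; ring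
      _ ≤ _ := by gcongr
  have h := lintegral_mono (μ := volume.restrict (Ioc (0 : ℝ) (2 * Real.pi))) key
  rw [lintegral_const_mul' _ _ ENNReal.ofReal_ne_top] at h
  have h2 := mul_le_mul_right h (ENNReal.ofReal (1 / (2 * Real.pi)))
  rw [mul_left_comm, lintegral_inv_norm_one_sub_sq (by rwa [hnc]), hnc,
    ← ENNReal.ofReal_mul (by positivity)] at h2
  have h3 : A ^ q * (1 - ‖w‖ * r) ^ (-(N * q - 2)) * (1 / (1 - (‖w‖ * r) ^ 2)) ≤
      A ^ q * (1 - ‖w‖ * r) ^ (-(N * q - 1)) := by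
    rw [mul_assoc]
    gcongr
    rw [show -(N * q - 1) = -(N * q - 2) + (-1 : ℝ) by ring, Real.rpow_add hx, Real.rpow_neg_one,
      ← one_div]
    gcongr
    nlinarith [norm_nonneg w, mul_nonneg (norm_nonneg w) hr0.le]
  have h4 := ENNReal.rpow_le_rpow (h2.trans (ENNReal.ofReal_le_ofReal h3))
    (show 0 ≤ 1 / q by positivity)
  rw [integralMean]
  refine h4.trans_eq ?_
  rw [ENNReal.ofReal_rpow_of_nonneg (by positivity) (by positivity), Real.mul_rpow (by positivity)
    (by positivity), ← Real.rpow_mul hA, ← Real.rpow_mul hx.le, mul_one_div_cancel hq.ne',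
    Real.rpow_one]
  congr 3
  field_simp

lemma mixedNorm_le_of_lintegral_le {p q : ℝ} (hp : 0 < p) {φ : ℝ → ℝ} {f : ℂ → ℂ} {C : ℝ}
    (hC : 0 ≤ C) (h : ∫⁻ r in Ioo (0 : ℝ) 1, integralMean q f r ^ p *
      ENNReal.ofReal (φ r ^ p / (1 - r)) ≤ ENNReal.ofReal C) :
    mixedNorm p q φ f ≤ ((C ^ (1 / p)).toNNReal : ℝ≥0) := by
  have := ENNReal.rpow_le_rpow h (show 0 ≤ 1 / p by positivity)
  rwa [ENNReal.ofReal_rpow_of_nonneg hC (by positivity)] at this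

/-- A pointwise bound of the weighted integral mean by a power of `1 - r`, integrated over an
annulus. -/
lemma lintegral_integralMean_le {p q : ℝ} (hp : 0 < p) {φ : ℝ → ℝ} (hφ : IsNormalFunction φ)
    {f : ℂ → ℂ} {u v t K : ℝ} {X : ℝ → ℝ} (hu : 0 ≤ u) (huv : u ≤ v) (hK : 0 ≤ K)
    (ht : 0 < t ∧ v ≤ 1 ∨ t < 0 ∧ v < 1) (hX0 : ∀ r ∈ Ioo u v, 0 ≤ X r)
    (hX : ∀ r ∈ Ioo u v, integralMean q f r ≤ ENNReal.ofReal (X r))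
    (hXφ : ∀ r ∈ Ioo u v, X r * φ r ≤ K * (1 - r) ^ t) :
    ∫⁻ r in Ioo u v, integralMean q f r ^ p * ENNReal.ofReal (φ r ^ p / (1 - r)) ≤
      ENNReal.ofReal (K ^ p * (((1 - u) ^ (t * p) - (1 - v) ^ (t * p)) / (t * p))) := by
  have hv : v ≤ 1 := ht.elim And.right fun h => h.2.le
  rw [ENNReal.ofReal_mul (by positivity), ← lintegral_one_sub_rpow huv
    (ht.imp (fun h => ⟨mul_pos h.1 hp, h.2⟩) fun h => ⟨mul_neg_of_neg_of_pos h.1 hp, h.2⟩),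
    ← lintegral_const_mul' _ _ ENNReal.ofReal_ne_top]
  refine setLIntegral_mono' measurableSet_Ioo fun r hr => ?_
  have hr1 : 0 < 1 - r := by linarith [hr.2]
  have hφr := hφ.pos r ⟨hu.trans hr.1.le, by linarith⟩
  have hXr := hX0 r hr
  refine (mul_le_mul_left (ENNReal.rpow_le_rpow (hX r hr) hp.le) _).trans ?_
  rw [ENNReal.ofReal_rpow_of_nonneg hXr hp.le, ← ENNReal.ofReal_mul (by positivity),
    ← ENNReal.ofReal_mul (by positivity)]
  refine ENNReal.ofReal_le_ofReal ?_
  rw [Real.rpow_sub_one hr1.ne', Real.rpow_mul hr1.le, ← mul_div_assoc, ← mul_div_assoc,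
    ← Real.mul_rpow hXr hφr.le, ← Real.mul_rpow hK (by positivity)]
  exact div_le_div_of_nonneg_right (Real.rpow_le_rpow (by positivity) (hXφ r hr) hp.le) hr1.le

/-! ### Test functions built from powers of the Cauchy kernel -/

lemma one_sub_mul_le_norm_one_sub_conj_mul (w z : ℂ) :
    1 - ‖w‖ * ‖z‖ ≤ ‖1 - starRingEnd ℂ w * z‖ := by
  simpa [norm_mul] using norm_sub_norm_le (1 : ℂ) (starRingEnd ℂ w * z)

lemma one_sub_conj_mul_ne_zero {w z : ℂ} (hw : ‖w‖ < 1) (hz : ‖z‖ < 1) :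
    1 - starRingEnd ℂ w * z ≠ 0 := by
  have := one_sub_mul_le_norm_one_sub_conj_mul w z
  rw [← norm_pos_iff]
  nlinarith [norm_nonneg z, norm_nonneg w]

/-- The function `A / (1 - w̄ z) ^ N` on the unit disc. -/
noncomputable def cauchyPower (A : ℝ) (N : ℕ) (w : ball (0 : ℂ) 1) : HolDisc :=
  ⟨(ball (0 : ℂ) 1).indicator fun z => A * ((1 - starRingEnd ℂ w * z) ^ N)⁻¹, by
    refine ⟨DifferentiableOn.congr (f := fun z => A * ((1 - starRingEnd ℂ w * z) ^ N)⁻¹)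
      (fun z hz => ?_) fun z hz => indicator_of_mem hz _, fun z hz => indicator_of_notMem hz _⟩
    refine DifferentiableAt.differentiableWithinAt ?_
    have := pow_ne_zero N
      (one_sub_conj_mul_ne_zero (mem_ball_zero_iff.1 w.2) (mem_ball_zero_iff.1 hz))
    fun_prop (disch := assumption)⟩

lemma iteratedDeriv_cauchyPower (A : ℝ) (N : ℕ) (w : ball (0 : ℂ) 1) (n : ℕ) :
    ∀ z ∈ ball (0 : ℂ) 1, iteratedDeriv n (cauchyPower A N w : ℂ → ℂ) z =
      A * N.ascFactorial n * starRingEnd ℂ w ^ n * ((1 - starRingEnd ℂ w * z) ^ (N + n))⁻¹ := by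
  induction n with
  | zero =>
    intro z hz
    simp [cauchyPower, indicator_of_mem hz]
  | succ n ih =>
    intro z hz
    have hne := one_sub_conj_mul_ne_zero (mem_ball_zero_iff.1 w.2) (mem_ball_zero_iff.1 hz)
    rw [iteratedDeriv_succ, EventuallyEq.deriv_eq (eventually_of_mem (isOpen_ball.mem_nhds hz) ih)]
    have h1 : HasDerivAt (fun z => 1 - starRingEnd ℂ (w : ℂ) * z) (-starRingEnd ℂ (w : ℂ)) z := by
      simpa using ((hasDerivAt_id z).const_mul (starRingEnd ℂ (w : ℂ))).const_sub 1
    have h2 := ((h1.pow (N + n)).inv (pow_ne_zero _ hne)).const_mul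
      (A * N.ascFactorial n * starRingEnd ℂ (w : ℂ) ^ n : ℂ)
    refine h2.deriv.trans ?_
    rcases Nat.eq_zero_or_pos (N + n) with h0 | h0
    · obtain ⟨rfl, rfl⟩ := Nat.add_eq_zero_iff.1 h0
      simp [Nat.ascFactorial_succ]
    · obtain ⟨k, hk⟩ : ∃ k, N + n = k + 1 := ⟨N + n - 1, by omega⟩
      rw [Nat.ascFactorial_succ, ← add_assoc, hk]
      simp only [Pi.pow_apply, Nat.add_sub_cancel]
      push_cast
      field_simp
      ring

/-- The amplitude that normalises `cauchyPower` in `H(p,q,φ)`. -/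
noncomputable def cauchyAmplitude (q : ℝ) (φ : ℝ → ℝ) (N : ℕ) (w : ℂ) : ℝ :=
  (1 - ‖w‖ ^ 2) ^ (N - 1 / q) / φ ‖w‖

/-- The test functions `(1 - |w|²)^(N - 1/q) / (φ(|w|) (1 - w̄ z)^N)`. -/
noncomputable def cauchyTest (q : ℝ) (φ : ℝ → ℝ) (N : ℕ) (w : ball (0 : ℂ) 1) : HolDisc :=
  cauchyPower (cauchyAmplitude q φ N w) N w

lemma cauchyAmplitude_pos {q : ℝ} {φ : ℝ → ℝ} (hφ : IsNormalFunction φ) (N : ℕ)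
    (w : ball (0 : ℂ) 1) : 0 < cauchyAmplitude q φ N w := by
  have hw := mem_ball_zero_iff.1 w.2
  have hφw := hφ.pos _ ⟨norm_nonneg (w : ℂ), hw⟩
  have : 0 < 1 - ‖(w : ℂ)‖ ^ 2 := by nlinarith [norm_nonneg (w : ℂ)]
  exact div_pos (by positivity) hφw

lemma cauchyAmplitude_mul_le {q : ℝ} {φ : ℝ → ℝ} (hφ : IsNormalFunction φ) {N : ℕ}
    (hN : 0 ≤ N - 1 / q) (w : ball (0 : ℂ) 1) :
    cauchyAmplitude q φ N w * φ ‖(w : ℂ)‖ ≤ 2 ^ (N - 1 / q) * (1 - ‖(w : ℂ)‖) ^ (N - 1 / q) := by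
  have hw := mem_ball_zero_iff.1 w.2
  have hw0 := norm_nonneg (w : ℂ)
  have hφw := hφ.pos _ ⟨norm_nonneg (w : ℂ), hw⟩
  rw [cauchyAmplitude, div_mul_cancel₀ _ hφw.ne', ← Real.mul_rpow (by norm_num) (by linarith)]
  exact Real.rpow_le_rpow (by nlinarith) (by nlinarith) hN

/-- The test functions are bounded in `H(p,q,φ)`. For `r < |w|` the monotonicity of
`φ(r) / (1 - r)^b` is used, for `r > |w|` that of `φ(r) / (1 - r)^a`. -/
lemma exists_mixedNorm_cauchyTest_le {p q : ℝ} (hp : 0 < p) (hq : 0 < q) {φ : ℝ → ℝ}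
    (hφ : IsNormalFunction φ) {b : ℝ}
    (hb : MonotoneOn (fun r => φ r / (1 - r) ^ b) (Ico 0 1)) {N : ℕ} (hN : 2 ≤ N * q)
    (hNb : b < N - 1 / q) (hN0 : 0 < N - 1 / q) :
    ∃ C : ℝ≥0, ∀ w, mixedNorm p q φ (cauchyTest q φ N w : ℂ → ℂ) ≤ C := by
  obtain ⟨a, -, ha, -, hanti, -, -, -⟩ := hφ.exists_exponents
  obtain ⟨α, hα⟩ : ∃ α : ℝ, α = N - 1 / q := ⟨_, rfl⟩
  rw [← hα] at hNb hN0
  refine ⟨_, fun w => mixedNorm_le_of_lintegral_le hp (C := (2 ^ α) ^ p / ((α - b) * p) +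
    (2 ^ α) ^ p / (a * p)) (by have := sub_pos.2 hNb; positivity) ?_⟩
  have hw := mem_ball_zero_iff.1 w.2
  obtain ⟨ρ, hρ⟩ : ∃ ρ : ℝ, ρ = ‖(w : ℂ)‖ := ⟨_, rfl⟩
  have hρ0 : 0 ≤ ρ := hρ ▸ norm_nonneg _
  have hρ1 : ρ < 1 := hρ ▸ hw
  have hD : 0 < 1 - ρ := by linarith
  have hφρ := hφ.pos ρ ⟨hρ0, hρ1⟩
  set A := cauchyAmplitude q φ N w with hA
  have hA0 : 0 < A := cauchyAmplitude_pos hφ N w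
  have hAφ : A * φ ρ ≤ 2 ^ α * (1 - ρ) ^ α := by
    rw [hρ, hα]; exact cauchyAmplitude_mul_le hφ (by linarith) w
  have hmean : ∀ r ∈ Ioo (0 : ℝ) 1, integralMean q (cauchyTest q φ N w : ℂ → ℂ) r ≤
      ENNReal.ofReal (A * (1 - ρ * r) ^ (-α)) := by
    intro r hr
    have := integralMean_cauchyKernel_le hq hN hA0.le (w := starRingEnd ℂ w) (by simpa using hw)
      (f := cauchyTest q φ N w) (fun z hz => by
        simp [cauchyTest, cauchyPower, indicator_of_mem hz, hA]) hr.1 hr.2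
    rwa [RCLike.norm_conj, ← hρ, ← hα] at this
  have h1 : ∫⁻ r in Ioo 0 ρ, integralMean q (cauchyTest q φ N w : ℂ → ℂ) r ^ p *
      ENNReal.ofReal (φ r ^ p / (1 - r)) ≤ ENNReal.ofReal ((2 ^ α) ^ p / ((α - b) * p)) := by
    have hαb := sub_pos.2 hNb
    refine (lintegral_integralMean_le hp hφ (K := 2 ^ α * (1 - ρ) ^ (α - b)) (t := b - α)
      (X := fun r => A * (1 - ρ * r) ^ (-α)) le_rfl hρ0 (by positivity)
      (Or.inr ⟨by linarith, hρ1⟩) (fun r hr => ?_) (fun r hr => hmean r ⟨hr.1, hr.2.trans hρ1⟩)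
      fun r hr => ?_).trans (ENNReal.ofReal_le_ofReal ?_)
    · have : 0 < 1 - ρ * r := by nlinarith [hr.1, hr.2]
      positivity
    · have hr1 : 0 < 1 - r := by linarith [hr.2]
      have hφr := hφ.pos r ⟨hr.1.le, hr.2.trans hρ1⟩
      have h1 := hb ⟨hr.1.le, hr.2.trans hρ1⟩ ⟨hρ0, hρ1⟩ hr.2.le
      simp only at h1
      rw [div_le_iff₀ (by positivity)] at h1
      have h2 : (1 - ρ * r) ^ (-α) ≤ (1 - r) ^ (-α) :=
        Real.rpow_le_rpow_of_nonpos hr1 (by nlinarith [hr.1]) (by linarith)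
      calc A * (1 - ρ * r) ^ (-α) * φ r
          ≤ A * (1 - r) ^ (-α) * (φ ρ / (1 - ρ) ^ b * (1 - r) ^ b) := by gcongr
        _ = (A * φ ρ) * ((1 - r) ^ (-α) * (1 - r) ^ b) / (1 - ρ) ^ b := by ring
        _ ≤ (2 ^ α * (1 - ρ) ^ α) * ((1 - r) ^ (-α) * (1 - r) ^ b) / (1 - ρ) ^ b := by gcongr
        _ = 2 ^ α * ((1 - ρ) ^ α / (1 - ρ) ^ b) * ((1 - r) ^ (-α) * (1 - r) ^ b) := by ring
        _ = _ := by
          rw [← Real.rpow_sub hD, ← Real.rpow_add hr1]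
          congr 2
          ring
    · rw [Real.mul_rpow (by positivity) (by positivity), ← Real.rpow_mul hD.le, sub_zero,
        Real.one_rpow, div_eq_mul_inv _ ((α - b) * p), mul_assoc]
      gcongr
      have h3 : (1 - ρ) ^ ((α - b) * p) * (1 - ρ) ^ ((b - α) * p) = 1 := by
        rw [← Real.rpow_add hD, show (α - b) * p + (b - α) * p = 0 by ring, Real.rpow_zero]
      have h4 : (1 - (1 - ρ) ^ ((b - α) * p)) / ((b - α) * p) =
          ((1 - ρ) ^ ((b - α) * p) - 1) / ((α - b) * p) := by
        rw [show (b - α) * p = -((α - b) * p) by ring, div_neg, ← neg_div, neg_sub]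
      rw [h4, ← mul_div_assoc, mul_sub, h3, mul_one, ← one_div]
      have : 0 ≤ (1 - ρ) ^ ((α - b) * p) := by positivity
      gcongr
      linarith
  have h2 : ∫⁻ r in Ioo ρ 1, integralMean q (cauchyTest q φ N w : ℂ → ℂ) r ^ p *
      ENNReal.ofReal (φ r ^ p / (1 - r)) ≤ ENNReal.ofReal ((2 ^ α) ^ p / (a * p)) := by
    refine (lintegral_integralMean_le hp hφ (K := 2 ^ α * (1 - ρ) ^ (-a)) (t := a)
      (X := fun r => A * (1 - ρ * r) ^ (-α)) hρ0 hρ1.le (by positivity)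
      (Or.inl ⟨ha, le_rfl⟩) (fun r hr => ?_) (fun r hr => hmean r ⟨hρ0.trans_lt hr.1, hr.2⟩)
      fun r hr => ?_).trans (ENNReal.ofReal_le_ofReal ?_)
    · have : 0 < 1 - ρ * r := by nlinarith [hr.1, hr.2]
      positivity
    · have hr1 : 0 < 1 - r := by linarith [hr.2]
      have hφr := hφ.pos r ⟨hρ0.trans hr.1.le, hr.2⟩
      have h1 := hanti ⟨hρ0, hρ1⟩ ⟨hρ0.trans hr.1.le, hr.2⟩ hr.1.le
      simp only at h1
      rw [div_le_iff₀ (by positivity)] at h1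
      have h2 : (1 - ρ * r) ^ (-α) ≤ (1 - ρ) ^ (-α) :=
        Real.rpow_le_rpow_of_nonpos hD (by nlinarith [hr.2]) (by linarith)
      calc A * (1 - ρ * r) ^ (-α) * φ r
          ≤ A * (1 - ρ) ^ (-α) * (φ ρ / (1 - ρ) ^ a * (1 - r) ^ a) := by gcongr
        _ = (A * φ ρ) * ((1 - ρ) ^ (-α) * (1 - r) ^ a) / (1 - ρ) ^ a := by ring
        _ ≤ (2 ^ α * (1 - ρ) ^ α) * ((1 - ρ) ^ (-α) * (1 - r) ^ a) / (1 - ρ) ^ a := by gcongr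
        _ = _ := by
          rw [Real.rpow_neg hD.le, Real.rpow_neg hD.le]
          have := Real.rpow_pos_of_pos hD α
          field_simp
    · rw [Real.mul_rpow (by positivity) (by positivity), ← Real.rpow_mul hD.le, sub_self,
        Real.zero_rpow (by positivity), sub_zero, mul_assoc, ← mul_div_assoc,
        ← Real.rpow_add hD, show -a * p + a * p = 0 by ring, Real.rpow_zero, mul_one_div]
  rw [← Ioc_union_Ioo_eq_Ioo hρ0 hρ1]
  refine (lintegral_union_le _ _ _).trans ?_
  rw [ENNReal.ofReal_add (by have := sub_pos.2 hNb; positivity) (by positivity),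
    setLIntegral_congr Ioo_ae_eq_Ioc.symm]
  exact add_le_add h1 h2

/-- At `w` itself the test function with parameter `w` attains the growth bound, up to a constant
and the factor `|w|^n`. -/
lemma norm_iteratedDeriv_cauchyTest_self {q : ℝ} {φ : ℝ → ℝ} (hφ : IsNormalFunction φ) (N n : ℕ)
    (w : ball (0 : ℂ) 1) : ‖iteratedDeriv n (cauchyTest q φ N w : ℂ → ℂ) w‖ =
      N.ascFactorial n * ‖(w : ℂ)‖ ^ n /
        (φ ‖(w : ℂ)‖ * (1 - ‖(w : ℂ)‖ ^ 2) ^ (1 / q + (n : ℝ))) := by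
  have hw := mem_ball_zero_iff.1 w.2
  have hD : 0 < 1 - ‖(w : ℂ)‖ ^ 2 := by nlinarith [norm_nonneg (w : ℂ)]
  have hφw := hφ.pos _ ⟨norm_nonneg (w : ℂ), hw⟩
  rw [cauchyTest, iteratedDeriv_cauchyPower _ _ _ _ _ w.2, mul_comm (starRingEnd ℂ (w : ℂ)) (w : ℂ),
    Complex.mul_conj, Complex.normSq_eq_norm_sq]
  have h1 : (1 - ((‖(w : ℂ)‖ ^ 2 : ℝ) : ℂ)) = ((1 - ‖(w : ℂ)‖ ^ 2 : ℝ) : ℂ) := by push_cast; rfl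
  rw [h1, norm_mul, norm_mul, norm_mul, norm_inv, norm_pow, norm_pow, RCLike.norm_conj,
    Complex.norm_natCast, Complex.norm_real, Complex.norm_real, Real.norm_of_nonneg hD.le,
    Real.norm_of_nonneg (cauchyAmplitude_pos hφ N w).le, cauchyAmplitude]
  have h2 : (1 - ‖(w : ℂ)‖ ^ 2) ^ (N + n) = (1 - ‖(w : ℂ)‖ ^ 2) ^ (N - 1 / q) *
      (1 - ‖(w : ℂ)‖ ^ 2) ^ (1 / q + (n : ℝ)) := by
    rw [← Real.rpow_add hD, ← Real.rpow_natCast]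
    congr 1
    push_cast
    ring
  have h3 : (1 - ‖(w : ℂ)‖ ^ 2) ^ (N - 1 / q) ≠ 0 := by positivity
  rw [h2]
  field_simp

lemma tendsto_iteratedDeriv_cauchyTest {q : ℝ} {φ : ℝ → ℝ} (hφ : IsNormalFunction φ) {b : ℝ}
    (hb : MonotoneOn (fun r => φ r / (1 - r) ^ b) (Ico 0 1)) {N : ℕ}
    (hNb : b < N - 1 / q) (hN0 : 0 < N - 1 / q) (n : ℕ) {w : ℕ → ball (0 : ℂ) 1}
    (hw : Tendsto (fun k => ‖(w k : ℂ)‖) atTop (𝓝 1)) {z : ℂ} (hz : z ∈ ball (0 : ℂ) 1) :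
    Tendsto (fun k => iteratedDeriv n (cauchyTest q φ N (w k) : ℂ → ℂ) z) atTop (𝓝 0) := by
  have hz1 := mem_ball_zero_iff.1 hz
  have hzp : 0 < 1 - ‖z‖ := by linarith
  have hφ0 := hφ.pos 0 (by simp)
  set α : ℝ := N - 1 / q with hα
  have hlim : Tendsto (fun k => 2 ^ α * (1 - ‖(w k : ℂ)‖) ^ (α - b) / φ 0 * N.ascFactorial n *
      ((1 - ‖z‖) ^ (N + n))⁻¹) atTop (𝓝 0) := by
    have h1 : Tendsto (fun k => (1 - ‖(w k : ℂ)‖) ^ (α - b)) atTop (𝓝 0) := by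
      have := (hw.const_sub 1).rpow_const (p := α - b) (Or.inr (by linarith))
      rwa [sub_self, Real.zero_rpow (by linarith)] at this
    simpa using (((h1.const_mul (2 ^ α)).div_const (φ 0)).mul_const
      (N.ascFactorial n : ℝ)).mul_const ((1 - ‖z‖) ^ (N + n))⁻¹
  refine squeeze_zero_norm (fun k => ?_) hlim
  have hk := mem_ball_zero_iff.1 (w k).2
  have hk0 := norm_nonneg (w k : ℂ)
  have hD : 0 < 1 - ‖(w k : ℂ)‖ := by linarith
  have hφk := hφ.pos _ ⟨hk0, hk⟩
  have hA := cauchyAmplitude_mul_le hφ hN0.le (w k)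
  have hA0 := cauchyAmplitude_pos (q := q) hφ N (w k)
  rw [cauchyTest, iteratedDeriv_cauchyPower _ _ _ _ _ hz, norm_mul, norm_mul, norm_mul, norm_inv,
    norm_pow, norm_pow, RCLike.norm_conj, Complex.norm_natCast, Complex.norm_real,
    Real.norm_of_nonneg hA0.le]
  have h1 : 1 - ‖z‖ ≤ ‖1 - starRingEnd ℂ (w k : ℂ) * z‖ :=
    le_trans (by nlinarith [norm_nonneg z]) (one_sub_mul_le_norm_one_sub_conj_mul _ _)
  have h2 : cauchyAmplitude q φ N (w k) ≤ 2 ^ α * (1 - ‖(w k : ℂ)‖) ^ (α - b) / φ 0 := by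
    have h3 := hb ⟨le_rfl, zero_lt_one⟩ ⟨hk0, hk⟩ hk0
    simp only [sub_zero, Real.one_rpow, div_one] at h3
    rw [le_div_iff₀ (by positivity)] at h3
    rw [le_div_iff₀ hφ0, Real.rpow_sub hD, ← mul_div_assoc, le_div_iff₀ (by positivity), mul_assoc]
    exact (mul_le_mul_of_nonneg_left h3 hA0.le).trans hA
  calc _ ≤ cauchyAmplitude q φ N (w k) * N.ascFactorial n * 1 * ((1 - ‖z‖) ^ (N + n))⁻¹ := by
        gcongr
        exact pow_le_one₀ hk0 hk.le
    _ ≤ _ := by rw [mul_one]; gcongr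

/-! ### The operator -/

lemma deriv_genIntOp (n : ℕ) (ϕ g : HolDisc) (hϕ : MapsTo (ϕ : ℂ → ℂ) (ball 0 1) (ball 0 1))
    (f : HolDisc) {z : ℂ} (hz : z ∈ ball (0 : ℂ) 1) :
    deriv (genIntOp n ϕ g hϕ f : ℂ → ℂ) z =
      iteratedDeriv n (f : ℂ → ℂ) ((ϕ : ℂ → ℂ) z) * (g : ℂ → ℂ) z := by
  rw [← (hasDerivAt_segmentIntegral (differentiableOn_integrand n ϕ g hϕ f) hz).deriv]
  refine EventuallyEq.deriv_eq ?_
  filter_upwards [isOpen_ball.mem_nhds hz] with w hw using indicator_of_mem hw _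

lemma genIntOp_apply_zero (n : ℕ) (ϕ g : HolDisc)
    (hϕ : MapsTo (ϕ : ℂ → ℂ) (ball 0 1) (ball 0 1)) (f : HolDisc) :
    (genIntOp n ϕ g hϕ f : ℂ → ℂ) 0 = 0 := by
  simp [genIntOp, segmentIntegral]

/-! ### The Bloch norm -/

namespace Bloch

variable {μ : DiscWeight}

lemma radial_mul_norm_deriv_le (f : Bloch μ) {z : ℂ} (hz : z ∈ ball (0 : ℂ) 1) :
    μ.radial ‖z‖ * ‖deriv (f.toHol : ℂ → ℂ) z‖ ≤ ‖f‖ := by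
  have := le_ciSup f.bddAbove ⟨z, hz⟩
  rw [norm_def]
  exact this.trans (le_add_of_nonneg_left (norm_nonneg _))

lemma norm_apply_zero_le (f : Bloch μ) : ‖(f.toHol : ℂ → ℂ) 0‖ ≤ ‖f‖ :=
  le_add_of_nonneg_right
    (Real.iSup_nonneg fun z => mul_nonneg (μ.radial_pos z).le (norm_nonneg _))

lemma norm_le_of_forall (f : Bloch μ) (h0 : (f.toHol : ℂ → ℂ) 0 = 0) {ε : ℝ}
    (h : ∀ z ∈ ball (0 : ℂ) 1, μ.radial ‖z‖ * ‖deriv (f.toHol : ℂ → ℂ) z‖ ≤ ε) : ‖f‖ ≤ ε := by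
  have : Nonempty (ball (0 : ℂ) 1) := ⟨⟨0, by simp⟩⟩
  rw [norm_def, h0, norm_zero, zero_add]
  exact ciSup_le fun z => h z z.2

lemma deriv_toHol_sub (f g : Bloch μ) {z : ℂ} (hz : z ∈ ball (0 : ℂ) 1) :
    deriv ((f - g).toHol : ℂ → ℂ) z =
      deriv (f.toHol : ℂ → ℂ) z - deriv (g.toHol : ℂ → ℂ) z :=
  deriv_sub (f.toHol.2.1.differentiableAt (isOpen_ball.mem_nhds hz))
    (g.toHol.2.1.differentiableAt (isOpen_ball.mem_nhds hz))

/-- A limit in `ℬ_μ` of functions that vanish at `0` and whose derivatives tend to `0` pointwise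
is `0`. -/
lemma eq_zero_of_tendsto {u : ℕ → Bloch μ} {L : Bloch μ} (hu : Tendsto u atTop (𝓝 L))
    (h0 : ∀ k, ((u k).toHol : ℂ → ℂ) 0 = 0)
    (hd : ∀ z ∈ ball (0 : ℂ) 1, Tendsto (fun k => deriv ((u k).toHol : ℂ → ℂ) z) atTop (𝓝 0)) :
    L = 0 := by
  have hn : Tendsto (fun k => ‖u k - L‖) atTop (𝓝 0) := tendsto_iff_norm_sub_tendsto_zero.1 hu
  have hL0 : (L.toHol : ℂ → ℂ) 0 = 0 := by
    have h1 : ∀ k, ‖(L.toHol : ℂ → ℂ) 0‖ ≤ ‖u k - L‖ := fun k => by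
      have h2 := norm_apply_zero_le (u k - L)
      have h3 : ((u k - L).toHol : ℂ → ℂ) 0 = ((u k).toHol : ℂ → ℂ) 0 - (L.toHol : ℂ → ℂ) 0 := rfl
      rwa [h3, h0 k, zero_sub, norm_neg] at h2
    exact norm_le_zero_iff.1 (ge_of_tendsto' hn h1)
  refine norm_le_zero_iff.1 (norm_le_of_forall L hL0 fun z hz => ?_)
  have h1 : ∀ k, μ.radial ‖z‖ * ‖deriv ((u k).toHol : ℂ → ℂ) z - deriv (L.toHol : ℂ → ℂ) z‖ ≤
      ‖u k - L‖ := fun k => by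
    rw [← deriv_toHol_sub _ _ hz]
    exact radial_mul_norm_deriv_le _ hz
  have h2 := le_of_tendsto_of_tendsto' (((hd z hz).sub_const _).norm.const_mul _) hn h1
  simpa using h2

end Bloch

/-! ### The limsup condition and sequential compactness -/

lemma limsup_normTendsToOne_eq_zero_iff {ϕ : HolDisc}
    (hϕ : MapsTo (ϕ : ℂ → ℂ) (ball 0 1) (ball 0 1)) {Q : ℂ → ℝ} :
    limsup (fun z => ENNReal.ofReal (Q z)) (normTendsToOne ϕ) = 0 ↔
      ∀ ε > 0, ∃ δ < 1, ∀ z ∈ ball (0 : ℂ) 1, δ < ‖(ϕ : ℂ → ℂ) z‖ → Q z ≤ ε := by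
  have hev : ∀ P : ℂ → Prop, (∀ᶠ z in normTendsToOne ϕ, P z) ↔
      ∃ δ < 1, ∀ z ∈ ball (0 : ℂ) 1, δ < ‖(ϕ : ℂ → ℂ) z‖ → P z := by
    intro P
    rw [normTendsToOne, eventually_inf_principal, eventually_comap, Metric.eventually_nhds_iff]
    constructor
    · rintro ⟨η, hη, h⟩
      refine ⟨1 - η, by linarith, fun z hz hδ => h ?_ z rfl hz⟩
      have := mem_ball_zero_iff.1 (hϕ hz)
      rw [Real.dist_eq, abs_lt]
      constructor <;> linarith
    · rintro ⟨δ, hδ, h⟩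
      refine ⟨1 - δ, by linarith, fun y hy z hzy hz => h z hz ?_⟩
      rw [Real.dist_eq, abs_lt] at hy
      linarith
  constructor
  · intro h ε hε
    refine (hev _).1 ((eventually_lt_of_limsup_lt (u := fun z => ENNReal.ofReal (Q z))
      (b := ENNReal.ofReal ε) ?_).mono fun z hz => ?_)
    · rw [h]; simpa using hε
    · exact ((ENNReal.ofReal_lt_ofReal_iff hε).1 hz).le
  · intro h
    refine le_antisymm (ENNReal.le_of_forall_pos_le_add fun ε hε _ => ?_) zero_le
    rw [zero_add]
    refine limsup_le_of_le (h := ?_)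
    refine ((hev _).2 (h ε hε)).mono fun z hz => ?_
    exact (ENNReal.ofReal_le_ofReal hz).trans_eq (ENNReal.ofReal_coe_nnreal)

lemma isCompact_closure_of_forall_subseq {X : Type*} [PseudoMetricSpace X] {s : Set X}
    (h : ∀ x : ℕ → X, (∀ k, x k ∈ s) → ∃ a, ∃ t : ℕ → ℕ, StrictMono t ∧
      Tendsto (x ∘ t) atTop (𝓝 a)) : IsCompact (closure s) := by
  refine IsSeqCompact.isCompact fun y hy => ?_
  have hpos : ∀ k : ℕ, (0 : ℝ) < 1 / (k + 1) := fun k => Nat.one_div_pos_of_nat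
  choose x hxs hx using fun k => Metric.mem_closure_iff.1 (hy k) _ (hpos k)
  obtain ⟨a, t, ht, hlim⟩ := h x hxs
  have hd : Tendsto (fun k => dist (x k) (y k)) atTop (𝓝 0) :=
    squeeze_zero (fun _ => dist_nonneg) (fun k => by rw [dist_comm]; exact (hx k).le)
      tendsto_one_div_add_atTop_nhds_zero_nat
  exact ⟨a, mem_closure_of_tendsto hlim (Eventually.of_forall fun k => hxs _), t, ht,
    (tendsto_iff_of_dist (hd.comp ht.tendsto_atTop)).1 hlim⟩

/-- The exponent `N` of the test functions: `2 ≤ N q` leaves room for the Poisson kernel in their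
integral means, and `b < N - 1/q` makes the radial integral up to `|w|` converge uniformly. -/
lemma IsNormalFunction.exists_cauchyTest_exponent {φ : ℝ → ℝ} (hφ : IsNormalFunction φ) {q : ℝ}
    (hq : 0 < q) : ∃ (b : ℝ) (N : ℕ), MonotoneOn (fun r => φ r / (1 - r) ^ b) (Ico 0 1) ∧
      2 ≤ N * q ∧ b < N - 1 / q ∧ 0 < (N - 1 / q : ℝ) := by
  obtain ⟨a, b, ha, hab, -, -, hmono, -⟩ := hφ.exists_exponents
  obtain ⟨N, hN⟩ := exists_nat_gt (max (b + 1 / q) (2 / q))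
  have h1 := (le_max_left _ _).trans_lt hN
  have h2 := (le_max_right _ _).trans_lt hN
  exact ⟨b, N, hmono, ((div_lt_iff₀ hq).1 h2).le, by linarith, by linarith⟩

lemma one_le_ascFactorial_of_two_le {N : ℕ} {q : ℝ} (hN : 2 ≤ N * q) (n : ℕ) :
    (1 : ℝ) ≤ N.ascFactorial n := by
  obtain ⟨k, rfl⟩ : ∃ k, N = k + 1 := Nat.exists_eq_succ_of_ne_zero fun h => by
    rw [h] at hN; norm_num at hN
  exact_mod_cast Nat.ascFactorial_pos k n

/-- Functions bounded in `H(p,q,φ)` are uniformly bounded on each smaller disc. -/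
lemma exists_locally_uniform_bound {p q : ℝ} (hp : 0 < p) (hq : 0 < q) {φ : ℝ → ℝ}
    (hφ : IsNormalFunction φ) (R : ℝ≥0) : ∃ M : ℝ → ℝ, ∀ f : HolDisc,
      mixedNorm p q φ (f : ℂ → ℂ) ≤ R → ∀ r < 1, ∀ z : ℂ, ‖z‖ ≤ r → ‖(f : ℂ → ℂ) z‖ ≤ M r := by
  obtain ⟨C, hC, hb⟩ := exists_growth_bound hp hq hφ
  obtain ⟨c, hc, hle⟩ := hφ.exists_le_mul
  refine ⟨fun r => C * R / (c * φ r * (1 - r) ^ (1 / q)), fun f hf r hr z hz => ?_⟩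
  have hz0 := norm_nonneg z
  have hφr := hφ.pos r ⟨hz0.trans hz, hr⟩
  have hφz := hφ.pos ‖z‖ ⟨hz0, hz.trans_lt hr⟩
  refine (hb f R f.2.1 hf z (by simpa using hz.trans_lt hr)).trans ?_
  have h1 := hle r ‖z‖ (hz0.trans hz) hr hz0 (by linarith)
  have h2 : 0 < 1 - r := by linarith
  beta_reduce
  gcongr

/-- If `C^n_{ϕ,g}` maps `H(p,q,φ)` into `ℬ_μ`, then `μ g` is bounded: apply it to a function whose
`n`-th derivative is bounded away from `0`. -/
lemma exists_radial_mul_norm_le {n : ℕ} {p q : ℝ} (hp : 0 < p) (hq : 0 < q)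
    {φ : ℝ → ℝ} (hφ : IsNormalFunction φ) {μ : DiscWeight}
    {ϕ g : HolDisc} {hϕ : MapsTo (ϕ : ℂ → ℂ) (ball 0 1) (ball 0 1)}
    (hC : MapsMixedToBloch p q φ μ (genIntOp n ϕ g hϕ)) :
    ∃ G : ℝ, 0 < G ∧ ∀ z ∈ ball (0 : ℂ) 1, μ.radial ‖z‖ * ‖(g : ℂ → ℂ) z‖ ≤ G := by
  obtain ⟨b, N, hmono, hN, hNb, hN0⟩ := hφ.exists_cauchyTest_exponent hq
  obtain ⟨C, hCw⟩ := exists_mixedNorm_cauchyTest_le hp hq hφ hmono hN hNb hN0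
  let w : ball (0 : ℂ) 1 := ⟨1 / 2, by simp; norm_num⟩
  obtain ⟨B, hB⟩ := hC (cauchyTest q φ N w) ((hCw w).trans_lt ENNReal.coe_lt_top)
  set A := cauchyAmplitude q φ N w with hA
  have hA0 : 0 < A := cauchyAmplitude_pos hφ N w
  set c : ℝ := A * (1 / 2) ^ n * (2 ^ (N + n))⁻¹ with hc
  have hc0 : 0 < c := by positivity
  refine ⟨(|B| + 1) / c, by positivity, fun z hz => ?_⟩
  have h1 := hB ⟨⟨z, hz⟩, rfl⟩
  simp only at h1
  rw [deriv_genIntOp _ _ _ _ _ hz, norm_mul] at h1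
  have hζ := hϕ hz
  have h2 : c ≤ ‖iteratedDeriv n (cauchyTest q φ N w : ℂ → ℂ) ((ϕ : ℂ → ℂ) z)‖ := by
    have hne := one_sub_conj_mul_ne_zero (mem_ball_zero_iff.1 w.2) (mem_ball_zero_iff.1 hζ)
    have hle : ‖1 - starRingEnd ℂ (w : ℂ) * (ϕ : ℂ → ℂ) z‖ ≤ 2 := by
      refine (norm_sub_le _ _).trans ?_
      rw [norm_one, norm_mul, RCLike.norm_conj]
      nlinarith [mem_ball_zero_iff.1 w.2, mem_ball_zero_iff.1 hζ, norm_nonneg (w : ℂ),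
        norm_nonneg ((ϕ : ℂ → ℂ) z)]
    have hwn : ‖(w : ℂ)‖ = 1 / 2 := by simp [w]
    have h1N := one_le_ascFactorial_of_two_le hN n
    rw [cauchyTest, iteratedDeriv_cauchyPower _ _ _ _ _ hζ, norm_mul, norm_mul, norm_mul, norm_inv,
      norm_pow, norm_pow, RCLike.norm_conj, Complex.norm_natCast, Complex.norm_real,
      Real.norm_of_nonneg hA0.le, hwn, hc]
    have h3 : 0 < ‖1 - starRingEnd ℂ (w : ℂ) * (ϕ : ℂ → ℂ) z‖ := norm_pos_iff.2 hne
    gcongr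
    exact le_mul_of_one_le_right hA0.le h1N
  rw [le_div_iff₀ hc0]
  have hμ := (μ.radial_pos ⟨z, hz⟩).le
  calc μ.radial ‖z‖ * ‖(g : ℂ → ℂ) z‖ * c
      ≤ μ.radial ‖z‖ * ‖(g : ℂ → ℂ) z‖ *
        ‖iteratedDeriv n (cauchyTest q φ N w : ℂ → ℂ) ((ϕ : ℂ → ℂ) z)‖ := by gcongr
    _ ≤ B := by linarith
    _ ≤ |B| + 1 := by linarith [le_abs_self B]

/-! ### The two implications -/

section

variable {n : ℕ} {p q : ℝ} {φ : ℝ → ℝ} {μ : DiscWeight} {ϕ g : HolDisc}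
  {hϕ : MapsTo (ϕ : ℂ → ℂ) (ball 0 1) (ball 0 1)}

/-- Under the limsup condition, locally uniform convergence of a bounded sequence in `H(p,q,φ)` is
mapped to convergence in the Bloch seminorm. The limit need not be known to lie in `H(p,q,φ)`, since
the pointwise growth bound passes to it. -/
lemma weighted_norm_sub_le_of_limsup (hp : 0 < p) (hq : 0 < q) (hφ : IsNormalFunction φ)
    (hC : MapsMixedToBloch p q φ μ (genIntOp n ϕ g hϕ))
    (hlim : ∀ ε > 0, ∃ δ < 1, ∀ z ∈ ball (0 : ℂ) 1, δ < ‖(ϕ : ℂ → ℂ) z‖ →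
      μ.radial ‖z‖ * ‖(g : ℂ → ℂ) z‖ /
        (φ ‖(ϕ : ℂ → ℂ) z‖ * (1 - ‖(ϕ : ℂ → ℂ) z‖ ^ 2) ^ (1 / q + (n : ℝ))) ≤ ε)
    {F : ℕ → HolDisc} {R : ℝ≥0} (hF : ∀ k, mixedNorm p q φ (F k : ℂ → ℂ) ≤ R) {f : HolDisc}
    (hFf : TendstoLocallyUniformlyOn (fun k => (F k : ℂ → ℂ)) f atTop (ball 0 1))
    {ε : ℝ} (hε : 0 < ε) :
    ∀ᶠ k in atTop, ∀ z ∈ ball (0 : ℂ) 1, μ.radial ‖z‖ *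
      ‖deriv (genIntOp n ϕ g hϕ (F k) : ℂ → ℂ) z - deriv (genIntOp n ϕ g hϕ f : ℂ → ℂ) z‖ ≤ ε := by
  obtain ⟨G, hG0, hG⟩ := exists_radial_mul_norm_le hp hq hφ hC
  obtain ⟨C, hC0, hb⟩ := exists_iteratedDeriv_growth_bound n hp hq hφ
  have hD := tendstoLocallyUniformlyOn_iteratedDeriv isOpen_ball (fun k => (F k).2.1) hFf n
  obtain ⟨δ, hδ1, hδ⟩ := hlim (ε / (2 * (C * R) + 1)) (by positivity)
  have hU := (tendstoLocallyUniformlyOn_iff_forall_isCompact isOpen_ball).1 hD _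
    (closedBall_subset_ball hδ1) (isCompact_closedBall (0 : ℂ) δ)
  filter_upwards [Metric.tendstoUniformlyOn_iff.1 hU (ε / G) (by positivity)] with k hk z hz
  have hζ := hϕ hz
  have hμg : 0 ≤ μ.radial ‖z‖ * ‖(g : ℂ → ℂ) z‖ :=
    mul_nonneg (μ.radial_pos ⟨z, hz⟩).le (norm_nonneg _)
  rw [deriv_genIntOp _ _ _ _ _ hz, deriv_genIntOp _ _ _ _ _ hz, ← sub_mul, norm_mul,
    mul_comm ‖_ - _‖, ← mul_assoc]
  rcases le_or_gt ‖(ϕ : ℂ → ℂ) z‖ δ with h | h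
  · have h1 := hk _ (by simpa using h)
    rw [dist_comm, dist_eq_norm] at h1
    calc _ ≤ G * (ε / G) := by gcongr; exact hG z hz
      _ = ε := by field_simp
  · set W := φ ‖(ϕ : ℂ → ℂ) z‖ * (1 - ‖(ϕ : ℂ → ℂ) z‖ ^ 2) ^ (1 / q + (n : ℝ)) with hW
    have hζ1 := mem_ball_zero_iff.1 hζ
    have hW0 : 0 < W := by
      have h1 := hφ.pos _ ⟨norm_nonneg ((ϕ : ℂ → ℂ) z), hζ1⟩
      have h2 : 0 < 1 - ‖(ϕ : ℂ → ℂ) z‖ ^ 2 := by nlinarith [norm_nonneg ((ϕ : ℂ → ℂ) z)]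
      positivity
    have h1 : ∀ k, ‖iteratedDeriv n (F k : ℂ → ℂ) ((ϕ : ℂ → ℂ) z)‖ ≤ C * R / W := fun k =>
      hb _ R (F k).2.1 (hF k) _ hζ
    have h2 : ‖iteratedDeriv n (f : ℂ → ℂ) ((ϕ : ℂ → ℂ) z)‖ ≤ C * R / W :=
      le_of_tendsto' (hD.tendsto_at hζ).norm h1
    calc _ ≤ μ.radial ‖z‖ * ‖(g : ℂ → ℂ) z‖ * (C * R / W + C * R / W) := by
          gcongr
          exact (norm_sub_le _ _).trans (add_le_add (h1 k) h2)
      _ = 2 * (C * R) * (μ.radial ‖z‖ * ‖(g : ℂ → ℂ) z‖ / W) := by ring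
      _ ≤ (2 * (C * R) + 1) * (ε / (2 * (C * R) + 1)) := by
          have := hδ z hz h
          gcongr
          linarith
      _ = ε := by field_simp

lemma isCompactMixedToBloch_of_limsup (hp : 0 < p) (hq : 0 < q) (hφ : IsNormalFunction φ)
    (hC : MapsMixedToBloch p q φ μ (genIntOp n ϕ g hϕ))
    (hlim : ∀ ε > 0, ∃ δ < 1, ∀ z ∈ ball (0 : ℂ) 1, δ < ‖(ϕ : ℂ → ℂ) z‖ →
      μ.radial ‖z‖ * ‖(g : ℂ → ℂ) z‖ /
        (φ ‖(ϕ : ℂ → ℂ) z‖ * (1 - ‖(ϕ : ℂ → ℂ) z‖ ^ 2) ^ (1 / q + (n : ℝ))) ≤ ε) :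
    IsCompactMixedToBloch (mixedToBloch hC) := by
  intro R
  refine isCompact_closure_of_forall_subseq fun x hx => ?_
  choose F hFR hFx using hx
  obtain ⟨M, hM⟩ := exists_locally_uniform_bound hp hq hφ R
  obtain ⟨h, s, hs, hh, hconv⟩ := exists_subseq_tendstoLocallyUniformlyOn
    (F := fun k => ((F k : HolDisc) : ℂ → ℂ)) (fun k => (F k : HolDisc).2.1)
    fun k => hM _ (hFR k)
  let f : HolDisc := ⟨(ball (0 : ℂ) 1).indicator h,
    hh.congr fun z hz => indicator_of_mem hz _, fun z hz => indicator_of_notMem hz _⟩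
  have hFf : TendstoLocallyUniformlyOn (fun k => ((F (s k) : HolDisc) : ℂ → ℂ)) f atTop
      (ball 0 1) := hconv.congr_right fun z hz => (indicator_of_mem hz _).symm
  have hev := fun (ε : ℝ) (hε : 0 < ε) => weighted_norm_sub_le_of_limsup hp hq hφ hC hlim
    (F := fun k => (F (s k) : HolDisc)) (fun k => hFR (s k)) hFf hε
  have hsub : ∀ k, ∀ z ∈ ball (0 : ℂ) 1,
      deriv ((genIntOp n ϕ g hϕ f - genIntOp n ϕ g hϕ (F (s k)) : HolDisc) : ℂ → ℂ) z =
      deriv (genIntOp n ϕ g hϕ f : ℂ → ℂ) z - deriv (genIntOp n ϕ g hϕ (F (s k)) : ℂ → ℂ) z :=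
    fun k z hz => deriv_sub ((genIntOp n ϕ g hϕ f).2.1.differentiableAt (isOpen_ball.mem_nhds hz))
      ((genIntOp n ϕ g hϕ (F (s k))).2.1.differentiableAt (isOpen_ball.mem_nhds hz))
  -- `f` need not be shown to lie in `H(p,q,φ)`: its image is within bounded distance of `ℬ_μ`.
  have hmem : genIntOp n ϕ g hϕ f ∈ blochSubmodule μ := by
    obtain ⟨k, hk⟩ := (hev 1 one_pos).exists
    have h1 : genIntOp n ϕ g hϕ f - genIntOp n ϕ g hϕ (F (s k)) ∈ blochSubmodule μ := by
      refine ⟨1, ?_⟩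
      rintro _ ⟨z, rfl⟩
      simp only
      rw [hsub k z z.2, norm_sub_rev]
      exact hk z z.2
    have h2 := (blochSubmodule μ).add_mem h1 (hC _ (F (s k)).2)
    rwa [sub_add_cancel] at h2
  let L : Bloch μ := (⟨genIntOp n ϕ g hϕ f, hmem⟩ : blochSubmodule μ)
  refine ⟨L, s, hs, ?_⟩
  rw [Metric.tendsto_nhds]
  intro ε hε
  filter_upwards [hev (ε / 2) (by positivity)] with k hk
  rw [dist_eq_norm]
  refine lt_of_le_of_lt (Bloch.norm_le_of_forall _ ?_ fun z hz => ?_) (half_lt_self hε)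
  · rw [Function.comp_apply, ← hFx]
    change (genIntOp n ϕ g hϕ (F (s k)) : ℂ → ℂ) 0 - (genIntOp n ϕ g hϕ f : ℂ → ℂ) 0 = 0
    rw [genIntOp_apply_zero, genIntOp_apply_zero, sub_zero]
  · rw [Bloch.deriv_toHol_sub _ _ hz, Function.comp_apply, ← hFx]
    exact hk z hz

lemma limsup_of_isCompactMixedToBloch (hp : 0 < p) (hq : 0 < q) (hφ : IsNormalFunction φ)
    (hC : MapsMixedToBloch p q φ μ (genIntOp n ϕ g hϕ))
    (hcpt : IsCompactMixedToBloch (mixedToBloch hC)) :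
    ∀ ε > 0, ∃ δ < 1, ∀ z ∈ ball (0 : ℂ) 1, δ < ‖(ϕ : ℂ → ℂ) z‖ →
      μ.radial ‖z‖ * ‖(g : ℂ → ℂ) z‖ /
        (φ ‖(ϕ : ℂ → ℂ) z‖ * (1 - ‖(ϕ : ℂ → ℂ) z‖ ^ 2) ^ (1 / q + (n : ℝ))) ≤ ε := by
  by_contra! hcon
  obtain ⟨ε, hε, hcon⟩ := hcon
  obtain ⟨b, N, hmono, hN, hNb, hN0⟩ := hφ.exists_cauchyTest_exponent hq
  obtain ⟨C, hCw⟩ := exists_mixedNorm_cauchyTest_le hp hq hφ hmono hN hNb hN0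
  have hlt : ∀ k : ℕ, 1 - (1 / 2 : ℝ) * (1 / (k + 1)) < 1 := fun k => by
    have : (0 : ℝ) < 1 / (k + 1) := Nat.one_div_pos_of_nat
    linarith
  choose z hz hzδ hzε using fun k : ℕ => hcon _ (hlt k)
  let w : ℕ → ball (0 : ℂ) 1 := fun k => ⟨(ϕ : ℂ → ℂ) (z k), hϕ (hz k)⟩
  have hw : Tendsto (fun k => ‖(w k : ℂ)‖) atTop (𝓝 1) := by
    refine tendsto_of_tendsto_of_tendsto_of_le_of_le ?_ tendsto_const_nhds (fun k => (hzδ k).le)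
      fun k => (mem_ball_zero_iff.1 (w k).2).le
    simpa only [mul_zero, sub_zero] using
      ((tendsto_one_div_add_atTop_nhds_zero_nat (𝕜 := ℝ)).const_mul (1 / 2)).const_sub 1
  let F : ℕ → mixedNormSpace p q φ := fun k =>
    ⟨cauchyTest q φ N (w k), (hCw (w k)).trans_lt ENNReal.coe_lt_top⟩
  obtain ⟨L, -, s, hs, hL⟩ := (hcpt C).tendsto_subseq (x := fun k => mixedToBloch hC (F k))
    fun k => subset_closure ⟨F k, hCw (w k), rfl⟩
  have hL0 : L = 0 := by
    refine Bloch.eq_zero_of_tendsto hL (fun k => genIntOp_apply_zero n ϕ g hϕ _) fun ζ hζ => ?_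
    have h1 := (tendsto_iteratedDeriv_cauchyTest hφ hmono hNb hN0 n
      (hw.comp hs.tendsto_atTop) (hϕ hζ) (w := w ∘ s)).mul_const ((g : ℂ → ℂ) ζ)
    rw [zero_mul] at h1
    exact h1.congr fun k => (deriv_genIntOp n ϕ g hϕ _ hζ).symm
  have hnorm := hL.norm
  rw [hL0, norm_zero] at hnorm
  have hlow : ∀ k, (1 / 2) ^ n * ε ≤ ‖mixedToBloch hC (F k)‖ := by
    intro k
    have h1 := Bloch.radial_mul_norm_deriv_le (mixedToBloch hC (F k)) (hz k)
    change _ * ‖deriv (genIntOp n ϕ g hϕ (cauchyTest q φ N (w k)) : ℂ → ℂ) (z k)‖ ≤ _ at h1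
    rw [deriv_genIntOp _ _ _ _ _ (hz k), norm_mul] at h1
    have h2 := norm_iteratedDeriv_cauchyTest_self (q := q) hφ N n (w k)
    change ‖iteratedDeriv n _ ((ϕ : ℂ → ℂ) (z k))‖ = _ at h2
    rw [h2] at h1
    have hhalf : 1 / 2 ≤ ‖(w k : ℂ)‖ := by
      refine le_trans ?_ (hzδ k).le
      have : (1 : ℝ) / (k + 1) ≤ 1 := by
        rw [div_le_one (by positivity)]
        linarith [(Nat.cast_nonneg k : (0 : ℝ) ≤ k)]
      linarith
    have hasc := one_le_ascFactorial_of_two_le hN n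
    refine le_trans ?_ h1
    have h3 := (hzε k).le
    calc (1 / 2) ^ n * ε ≤ 1 * ‖(w k : ℂ)‖ ^ n * (μ.radial ‖z k‖ * ‖(g : ℂ → ℂ) (z k)‖ /
        (φ ‖(w k : ℂ)‖ * (1 - ‖(w k : ℂ)‖ ^ 2) ^ (1 / q + (n : ℝ)))) := by
          rw [one_mul]; gcongr
      _ ≤ N.ascFactorial n * ‖(w k : ℂ)‖ ^ n * (μ.radial ‖z k‖ * ‖(g : ℂ → ℂ) (z k)‖ /
        (φ ‖(w k : ℂ)‖ * (1 - ‖(w k : ℂ)‖ ^ 2) ^ (1 / q + (n : ℝ)))) := by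
          have : 0 ≤ μ.radial ‖z k‖ * ‖(g : ℂ → ℂ) (z k)‖ /
            (φ ‖(w k : ℂ)‖ * (1 - ‖(w k : ℂ)‖ ^ 2) ^ (1 / q + (n : ℝ))) := hε.le.trans h3
          gcongr
      _ = _ := by ring
  have hfin := ge_of_tendsto' hnorm fun k => hlow (s k)
  have : 0 < (1 / 2 : ℝ) ^ n * ε := by positivity
  linarith

end

theorem corollary2p8 (n : ℕ) (p q : ℝ) (hp : 0 < p) (hq : 0 < q)
    (φ : ℝ → ℝ) (hφ : IsNormalFunction φ) (μ : DiscWeight)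
    (ϕ g : HolDisc) (hϕ : MapsTo (ϕ : ℂ → ℂ) (ball 0 1) (ball 0 1))
    (hC : MapsMixedToBloch p q φ μ (genIntOp n ϕ g hϕ)) :
    IsCompactMixedToBloch (mixedToBloch hC) ↔
      limsup (fun z : ℂ => ENNReal.ofReal
        (μ.radial ‖z‖ * ‖(g : ℂ → ℂ) z‖ /
          (φ ‖(ϕ : ℂ → ℂ) z‖ * (1 - ‖(ϕ : ℂ → ℂ) z‖ ^ 2) ^ (1 / q + (n : ℝ)))))
        (normTendsToOne ϕ) = 0 := by
  rw [limsup_normTendsToOne_eq_zero_iff hϕ]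
  exact ⟨limsup_of_isCompactMixedToBloch hp hq hφ hC, isCompactMixedToBloch_of_limsup hp hq hφ hC⟩
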